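/- **Setting.** Let $\mathcal X,\mathcal Y,\mathcal Z,\widetilde{\mathcal Z},\mathfrak Z$ be finite-dimensional real Hilbert spaces. For a finite-dimensional real Hilbert space $\mathcal K$, let $\Gamma_0(\mathcal K)$ be the set of proper lower semicontinuous convex functions $\mathcal K\to(-\infty,\infty]$, let $\iota_C$ be the indicator function of a set $C$ ($0$ on $C$, $\infty$ elsewhere), let $P_C$ be the metric projection onto a nonempty closed convex set $C$, and for $g\in\Gamma_0(\mathcal K)$, $\gamma>0$ let $$\operatorname{Prox}_{\gamma g}(x)=\operatorname*{argmin}_{v\in\mathcal K}\Big[g(v)+\tfrac1{2\gamma}\|v-x\|^2\Big],\qquad \partial g(z)=\{u\in\mathcal K\mid (\forall w\in\mathcal K)\ \langle w-z,u\rangle+g(z)\le g(w)\}.$$ Let $\mathbf C\subset\mathfrak Z$ be closed and convex, let $\mathfrak C:\mathcal X\to\mathfrak Z$, $A:\mathcal X\to\mathcal Y$, $\mathfrak L:\mathcal X\to\mathcal Z$, $B:\mathcal Z\to\widetilde{\mathcal Z}$ be linear, let $\mu>0$, let $f\in\Gamma_0(\mathcal Y)$ be real-valued and continuously differentiable on $\mathcal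 Y$, and let $\Psi\in\Gamma_0(\mathcal Z)$ be coercive, i.e. $\Psi(u)\to\infty$ as $\|u\|\to\infty$. Assume that some $x\in\mathcal X$ satisfies $\Psi(\mathfrak Lx)<\infty$ and $\mathfrak Cx\in\mathbf C$. Put $$\Psi_B(u)=\Psi(u)-\min_{v\in\mathcal Z}\Big[\Psi(v)+\tfrac12\|B(u-v)\|^2\Big],\qquad J(x)=f(Ax)+\mu\Psi_B(\mathfrak Lx),\qquad \mathfrak d(x)=f(Ax)-\tfrac{\mu}{2}\|B\mathfrak Lx\|^2,$$ and let $\mathcal S$ be the set of global minimizers of $J$ over $\{x\in\mathcal X\mid\mathfrak Cx\in\mathbf C\}$. **Assumptions.** (i) $\nabla\mathfrak d$ is $\beta$-Lipschitz continuous on $\mathcal X$ for some $\beta>0$; (ii) $\mathfrak d\in\Gamma_0(\mathcal X)$; (iii) $\mathcal S\ne\emptyset$; (iv) $\partial(\mu\Psi\circ\mathfrak L+\iota_{\mathbf C}\circ\mathfrak C)(x)=\mu\mathfrak L^*\partial\Psi(\mathfrak Lx)+\mathfrak C^*\partial\iota_{\mathbf C}(\mathfrak Cx)$ for every $x\in\mathcal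 X$. **The operator.** Let $\mathcal H=\mathcal X\times\mathcal Z\times\mathcal Z\times\mathfrak Z$ with the product inner product and $\Xi(x,v,w,z)=x$. For $\sigma,\tau>0$ let $T:\mathcal H\to\mathcal H$, $T(x,v,w,z)=(\xi,\zeta,\eta,\varsigma)$, where $$\begin{aligned} \xi&=x-\tfrac1\sigma\nabla\mathfrak d(x)-\tfrac\mu\sigma\mathfrak L^*B^*Bv-\tfrac\mu\sigma\mathfrak L^*w-\tfrac\mu\sigma\mathfrak C^*z,\\ \zeta&=\operatorname{Prox}_{\frac\mu\tau\Psi}\Big[\tfrac{2\mu}\tau B^*B\mathfrak L\xi-\tfrac\mu\tau B^*B\mathfrak Lx+\big(\mathrm{Id}-\tfrac\mu\tau B^*B\big)v\Big],\\ \eta&=(\mathrm{Id}-\operatorname{Prox}_\Psi)(2\mathfrak L\xi-\mathfrak Lx+w),\\ \varsigma&=(\mathrm{Id}-P_{\mathbf C})(2\mathfrak C\xi-\mathfrak Cx+z). \end{aligned}$$ Let $\operatorname{Fix}T=\{h\in\mathcal H\mid h=T(h)\}$. **Theorem.** Let $\rho=1/\max\{\beta,\mu\|B\|_{\mathrm{op}}^2\}>0$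 and $\kappa=\|\mathfrak L^*\mathfrak L+\mathfrak C^*\mathfrak C\|_{\mathrm{op}}$. (a) For all $\sigma,\tau>0$, $\mathcal S=\Xi(\operatorname{Fix}T)$. (b) Let $\sigma>0$ and $\tau>\frac1{2\rho}$ satisfy $$\sigma>\mu\kappa+\frac{2\rho\mu^2\|B^*B\mathfrak L\|_{\mathrm{op}}^2+\tau}{2\rho\tau-1}.$$ Then the self-adjoint operator $$\mathfrak P=\begin{bmatrix}\sigma\mathrm{Id}&-\mu\mathfrak L^*B^*B&-\mu\mathfrak L^*&-\mu\mathfrak C^*\\-\mu B^*B\mathfrak L&\tau\mathrm{Id}&0&0\\-\mu\mathfrak L&0&\mu\mathrm{Id}&0\\-\mu\mathfrak C&0&0&\mu\mathrm{Id}\end{bmatrix}$$ on $\mathcal H$ is positive definite, the number $$\theta=\frac{\sigma+\tau-\mu\kappa}{\rho\big(\sigma\tau-\tau\mu\kappa-\mu^2\|B^*B\mathfrak L\|_{\mathrm{op}}^2\big)}$$ lies in $(0,2)$, and $T$ is $\frac{2}{4-\theta}$-averaged nonexpansive with respect to $\|h\|_{\mathfrak P}=\sqrt{\langle h,\mathfrak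 Ph\rangle}$, i.e. with $\alpha=\frac2{4-\theta}\in(0,1)$ one has $T=(1-\alpha)\mathrm{Id}+\alpha N$ for some $N:\mathcal H\to\mathcal H$ with $\|Nh-Nh'\|_{\mathfrak P}\le\|h-h'\|_{\mathfrak P}$ for all $h,h'\in\mathcal H$. (c) For $(\sigma,\tau)$ as in (b) and any $h_0\in\mathcal H$, the sequence $h_{k+1}=T(h_k)$ converges to a point of $\operatorname{Fix}T$, and $x_k=\Xi(h_k)$ converges to a point of $\mathcal S$. -/

import Mathlib

open Filter Topology

noncomputable section

namespace NRC

section ConvexAnalysis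

variable {H : Type*} [NormedAddCommGroup H] [InnerProductSpace ℝ H]

/-- `Γ₀(H)`: proper lower semicontinuous convex functions `H → (-∞, ∞]`. -/
structure Gamma0 (g : H → EReal) : Prop where
  ne_bot : ∀ x, g x ≠ ⊥
  proper : ∃ x, g x < ⊤
  lsc : LowerSemicontinuous g
  convex : ∀ x y : H, ∀ a : ℝ, 0 < a → a < 1 →
    g (a • x + (1 - a) • y) ≤ (a : EReal) * g x + ((1 - a : ℝ) : EReal) * g y

/-- Coercivity: `g x → ∞` as `‖x‖ → ∞`. -/
def Coercive (g : H → EReal) : Prop :=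
  Tendsto g (Bornology.cobounded H) (𝓝 ⊤)

/-- The subdifferential `∂g(z)`. -/
def subdiff (g : H → EReal) (z : H) : Set H :=
  {u | ∀ w : H, ((inner ℝ (w - z) u : ℝ) : EReal) + g z ≤ g w}

open Classical in
/-- The indicator function `ι_C`, with values `0` on `C` and `∞` off `C`. -/
def indicatorFn (C : Set H) (x : H) : EReal := if x ∈ C then 0 else ⊤

/-- `p` minimizes `v ↦ g(v) + ‖v - x‖² / (2γ)`. -/
def IsProx (γ : ℝ) (g : H → EReal) (x p : H) : Prop :=
  ∀ v : H, g p + ((1 / (2 * γ) * ‖p - x‖ ^ 2 : ℝ) : EReal) ≤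
    g v + ((1 / (2 * γ) * ‖v - x‖ ^ 2 : ℝ) : EReal)

/-- The proximity operator `Prox_{γ g}`: the minimizer of `v ↦ g(v) + ‖v - x‖² / (2γ)`
(it exists and is unique for `γ > 0` and `g ∈ Γ₀(H)`). -/
def prox (γ : ℝ) (g : H → EReal) (x : H) : H :=
  Classical.epsilon (IsProx γ g x)

/-- `p` is a point of `C` nearest to `x`. -/
def IsNearest (C : Set H) (x p : H) : Prop :=
  p ∈ C ∧ ∀ u ∈ C, ‖x - p‖ ≤ ‖x - u‖

/-- The metric projection `P_C`: the point of `C` nearest to `x`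
(it exists and is unique for a nonempty closed convex `C`). -/
def metricProj (C : Set H) (x : H) : H :=
  Classical.epsilon (IsNearest C x)

/-- `P ≻ 0`: `P` is self-adjoint and `⟨h, P h⟩ > 0` for every `h ≠ 0`. -/
def PosDef (P : H →ₗ[ℝ] H) : Prop :=
  P.IsSymmetric ∧ ∀ h : H, h ≠ 0 → 0 < inner ℝ h (P h)

/-- `‖h‖_P = √⟨h, P h⟩`. -/
def normWrt (P : H →ₗ[ℝ] H) (h : H) : ℝ := Real.sqrt (inner ℝ h (P h))

/-- `T` is nonexpansive with respect to `‖·‖_P`. -/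
def NonexpansiveWrt (P : H →ₗ[ℝ] H) (T : H → H) : Prop :=
  ∀ x y : H, normWrt P (T x - T y) ≤ normWrt P (x - y)

/-- `T` is `α`-averaged nonexpansive with respect to `‖·‖_P`. -/
def AveragedWrt (P : H →ₗ[ℝ] H) (α : ℝ) (T : H → H) : Prop :=
  (0 < α ∧ α < 1) ∧
    ∃ N : H → H, NonexpansiveWrt P N ∧ ∀ x, T x = (1 - α) • x + α • N x

end ConvexAnalysis

open ContinuousLinearMap (adjoint)

/-- The nonconvexly regularized model: minimize `J = f ∘ A + μ Ψ_B ∘ L` subject to `K x ∈ C`,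
with the data and standing conditions of the problem. -/
structure Model (X Y Z Zt W : Type*)
    [NormedAddCommGroup X] [InnerProductSpace ℝ X]
    [NormedAddCommGroup Y] [InnerProductSpace ℝ Y]
    [NormedAddCommGroup Z] [InnerProductSpace ℝ Z]
    [NormedAddCommGroup Zt] [InnerProductSpace ℝ Zt]
    [NormedAddCommGroup W] [InnerProductSpace ℝ W] where
  C : Set W
  C_closed : IsClosed C
  C_convex : Convex ℝ C
  K : X →L[ℝ] W
  A : X →L[ℝ] Y
  f : Y → ℝ
  f_gamma0 : Gamma0 (fun y => (f y : EReal))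
  f_contDiff : ContDiff ℝ 1 f
  μ : ℝ
  μ_pos : 0 < μ
  L : X →L[ℝ] Z
  B : Z →L[ℝ] Zt
  Ψ : Z → EReal
  Ψ_gamma0 : Gamma0 Ψ
  Ψ_coercive : Coercive Ψ
  feasible : ∃ x, Ψ (L x) < ⊤ ∧ K x ∈ C

/-- The Hilbert space `X × Z × Z × W` with the product inner product. -/
abbrev Prod4 (X Z W : Type*) : Type _ :=
  WithLp 2 (X × WithLp 2 (Z × WithLp 2 (Z × W)))

/-- The point `(x, v, w, z)` of `X × Z × Z × W`. -/
abbrev mk4 {X Z W : Type*} (x : X) (v w : Z) (z : W) : Prod4 X Z W :=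
  WithLp.toLp 2 (x, WithLp.toLp 2 (v, WithLp.toLp 2 (w, z)))

/-- `Ξ : (x, v, w, z) ↦ x`. -/
abbrev Xi {X Z W : Type*} (h : Prod4 X Z W) : X := h.fst

namespace Model

variable {X Y Z Zt W : Type*}
  [NormedAddCommGroup X] [InnerProductSpace ℝ X] [CompleteSpace X]
  [NormedAddCommGroup Y] [InnerProductSpace ℝ Y]
  [NormedAddCommGroup Z] [InnerProductSpace ℝ Z] [CompleteSpace Z]
  [NormedAddCommGroup Zt] [InnerProductSpace ℝ Zt] [CompleteSpace Zt]
  [NormedAddCommGroup W] [InnerProductSpace ℝ W] [CompleteSpace W]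
  (M : Model X Y Z Zt W)

/-- The generalized Moreau enhancement `Ψ_B`. -/
def gme (u : Z) : EReal :=
  M.Ψ u - ⨅ v : Z, (M.Ψ v + ((1 / 2 * ‖M.B (u - v)‖ ^ 2 : ℝ) : EReal))

/-- The cost function `J = f ∘ A + μ Ψ_B ∘ L`. -/
def J (x : X) : EReal := (M.f (M.A x) : EReal) + (M.μ : EReal) * M.gme (M.L x)

/-- The set of global minimizers of `J` over `{x | K x ∈ C}`. -/
def solutionSet : Set X :=
  {x | M.K x ∈ M.C ∧ ∀ x' : X, M.K x' ∈ M.C → M.J x ≤ M.J x'}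

/-- `𝔡(x) = f(A x) - (μ/2) ‖B L x‖²`. -/
def d (x : X) : ℝ := M.f (M.A x) - M.μ / 2 * ‖M.B (M.L x)‖ ^ 2

/-- The operator `B* B`. -/
def BB : Z →L[ℝ] Z := adjoint M.B ∘L M.B

/-- The assumptions of the convergence analysis; `β` is a Lipschitz constant of `∇𝔡`. -/
structure Assumptions (β : ℝ) : Prop where
  β_pos : 0 < β
  lipschitz : ∀ x y : X, ‖gradient M.d x - gradient M.d y‖ ≤ β * ‖x - y‖
  overall_convexity : Gamma0 (fun x => (M.d x : EReal))
  exists_minimizer : M.solutionSet.Nonempty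
  subdiff_rule : ∀ x : X,
    subdiff (fun x' => (M.μ : EReal) * M.Ψ (M.L x') + indicatorFn M.C (M.K x')) x =
      {u | ∃ p ∈ subdiff M.Ψ (M.L x), ∃ q ∈ subdiff (indicatorFn M.C) (M.K x),
        u = M.μ • adjoint M.L p + adjoint M.K q}

/-- The `x`-component `ξ` of `T (x, v, w, z)`. -/
def xi (σ : ℝ) (h : Prod4 X Z W) : X :=
  let x := h.fst
  let v := h.snd.fst
  let w := h.snd.snd.fst
  let z := h.snd.snd.snd
  (x - (1 / σ) • gradient M.d x) - (M.μ / σ) • adjoint M.L (M.BB v)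
    - (M.μ / σ) • adjoint M.L w - (M.μ / σ) • adjoint M.K z

/-- The operator `T : (x, v, w, z) ↦ (ξ, ζ, η, ς)`. -/
def T (σ τ : ℝ) (h : Prod4 X Z W) : Prod4 X Z W :=
  let x := h.fst
  let v := h.snd.fst
  let w := h.snd.snd.fst
  let z := h.snd.snd.snd
  let ξ := M.xi σ h
  let ζ := prox (M.μ / τ) M.Ψ
    ((2 * M.μ / τ) • M.BB (M.L ξ) - (M.μ / τ) • M.BB (M.L x) + (v - (M.μ / τ) • M.BB v))
  let a := (2 : ℝ) • M.L ξ - M.L x + w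
  let η := a - prox 1 M.Ψ a
  let b := (2 : ℝ) • M.K ξ - M.K x + z
  let ς := b - metricProj M.C b
  mk4 ξ ζ η ς

/-- The fixed point set of `T`. -/
def fixT (σ τ : ℝ) : Set (Prod4 X Z W) := {h | h = M.T σ τ h}

/-- The block operator `𝔓` on `X × Z × Z × W`. -/
def P (σ τ : ℝ) : Prod4 X Z W →ₗ[ℝ] Prod4 X Z W where
  toFun h :=
    let x := h.fst
    let v := h.snd.fst
    let w := h.snd.snd.fst
    let z := h.snd.snd.snd
    mk4
      (σ • x - M.μ • adjoint M.L (M.BB v) - M.μ • adjoint M.L w - M.μ • adjoint M.K z)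
      (-(M.μ • M.BB (M.L x)) + τ • v)
      (-(M.μ • M.L x) + M.μ • w)
      (-(M.μ • M.K x) + M.μ • z)
  map_add' h h' := by
    simp only [WithLp.add_fst, WithLp.add_snd, map_add, smul_add, ← WithLp.toLp_add,
      Prod.mk_add_mk]
    refine congrArg (WithLp.toLp 2) (Prod.ext ?_ (congrArg (WithLp.toLp 2)
      (Prod.ext ?_ (congrArg (WithLp.toLp 2) (Prod.ext ?_ ?_))))) <;> dsimp only <;> abel
  map_smul' c h := by
    simp only [WithLp.smul_fst, WithLp.smul_snd, map_smul, ← WithLp.toLp_smul,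
      Prod.smul_mk, smul_sub, smul_add, smul_neg, RingHom.id_apply, smul_comm c]

/-- `ρ = 1 / max {β, μ ‖B‖²}`. -/
def rho (β : ℝ) : ℝ := 1 / max β (M.μ * ‖M.B‖ ^ 2)

/-- `‖L* L + K* K‖`. -/
def normLK : ℝ := ‖adjoint M.L ∘L M.L + adjoint M.K ∘L M.K‖

/-- The step size condition on `(σ, τ)`. -/
def StepCondition (β σ τ : ℝ) : Prop :=
  0 < σ ∧ 1 / (2 * M.rho β) < τ ∧
    M.μ * M.normLK + (2 * M.rho β * M.μ ^ 2 * ‖M.BB ∘L M.L‖ ^ 2 + τ) / (2 * M.rho β * τ - 1) < σ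

/-- The constant `θ` of the averagedness estimate. -/
def theta (β σ τ : ℝ) : ℝ :=
  (σ + τ - M.μ * M.normLK) /
    (M.rho β * (σ * τ - τ * M.μ * M.normLK - M.μ ^ 2 * ‖M.BB ∘L M.L‖ ^ 2))

end Model

end NRC

end

/-!
Write `N_C` for the subdifferential of `ι_C`.

*Fixed points.* By the resolvent characterizations of the proximity operator and of the metric
projection, `(x, v, w, z)` is a fixed point of `T` if and only if
`∇𝔡(x) + μ L*B*B v + μ L* w + μ K* z = 0`, `B*B(L x - v) ∈ ∂Ψ(v)`, `w ∈ ∂Ψ(L x)` and `z ∈ N_C(K x)`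
(`Model.mem_fixT_iff`). The second condition says that `v` attains the minimum in the definition of
the envelope that `Ψ_B` subtracts from `Ψ`; it makes `B*B(L x - v)` a subgradient of the envelope
at `L x`. If this system holds, then `𝔡`, the regularizer, the constraint and the envelope term
have affine minorants at `x` that add up to a constant, so `x` is a global minimizer
(`Model.IsKKT.mem_solutionSet`). Conversely, the affine minorant of the envelope at `L x` gives a
majorant of `J` that agrees with `J` at a minimizer `x`; this majorant is the sum of a
differentiable function, with gradient `∇𝔡(x) + μ L*B*B v` at `x`, and of `μ Ψ ∘ L`. Fermat's rule
and the assumed sum rule produce `w` and `z` (`Model.exists_isKKT_of_mem_solutionSet`).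

*Averagedness.* `T` is a forward-backward step in the metric of `P`: one has
`P (h - T h) ∈ F h + G (T h)` with `F` the `ρ`-cocoercive map `(∇𝔡, μ B*B, 0, 0)` (by the
Baillon–Haddad theorem) and `G` monotone (`Model.exists_P_sub_T`). Put `δ = h - h'` and
`e = δ - (T h - T h')`. Monotonicity of `G` and cocoercivity of `F` give
`⟪δ - e, P e⟫ ≥ -(‖e_x‖² + ‖e_v‖²) / (4 ρ)`, where `e_x` and `e_v` are the first two components.
The step size condition makes `‖e_x‖² + ‖e_v‖² ≤ ρ θ ⟪e, P e⟫` with `θ < 2`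
(`Model.StepCondition.norm_sq_le_inner_P`), whence `⟪δ, P e⟫ ≥ (1 - θ / 4) ⟪e, P e⟫`. This is
averagedness with constant `2 / (4 - θ)`.

*Convergence* is the Krasnosel'skii–Mann theorem (`AveragedWrt.exists_tendsto`), applicable since
`Fix T` is nonempty together with the solution set.
-/

set_option linter.unusedSectionVars false

noncomputable section

namespace NRC

/-! ### Subdifferentials, indicator functions and Fermat's rule -/

theorem indicatorFn_ne_bot {α : Type*} (C : Set α) (x : α) : indicatorFn C x ≠ ⊥ := by
  unfold indicatorFn
  split_ifs <;> simp

theorem indicatorFn_of_mem {α : Type*} {C : Set α} {x : α} (h : x ∈ C) : indicatorFn C x = 0 :=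
  if_pos h

theorem indicatorFn_of_notMem {α : Type*} {C : Set α} {x : α} (h : x ∉ C) : indicatorFn C x = ⊤ :=
  if_neg h

theorem indicatorFn_proper {α : Type*} {C : Set α} (hC : C.Nonempty) :
    ∃ x, indicatorFn C x < ⊤ := by
  obtain ⟨x, hx⟩ := hC
  exact ⟨x, by simp [indicatorFn_of_mem hx]⟩

section ConvexAnalysis

variable {H : Type*} [NormedAddCommGroup H] [InnerProductSpace ℝ H]

theorem ne_top_of_mem_subdiff {g : H → EReal} (hp : ∃ x, g x < ⊤) {z u : H}
    (hu : u ∈ subdiff g z) : g z ≠ ⊤ := by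
  obtain ⟨x, hx⟩ := hp
  intro h
  have := hu x
  rw [h, EReal.coe_add_top] at this
  exact absurd (this.trans_lt hx) (lt_irrefl _)

theorem subdiff_monotone {g : H → EReal} (hb : ∀ x, g x ≠ ⊥) (hp : ∃ x, g x < ⊤) {z z' u u' : H}
    (hu : u ∈ subdiff g z) (hu' : u' ∈ subdiff g z') : 0 ≤ inner ℝ (z - z') (u - u') := by
  have h1 := hu z'
  have h2 := hu' z
  have e1 := EReal.coe_toReal (ne_top_of_mem_subdiff hp hu) (hb z)
  have e2 := EReal.coe_toReal (ne_top_of_mem_subdiff hp hu') (hb z')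
  rw [← e1, ← e2] at h1 h2
  norm_cast at h1 h2
  have e3 : inner ℝ (z' - z) u = - inner ℝ (z - z') u := by rw [← inner_neg_left, neg_sub]
  rw [inner_sub_right]
  linarith

/-- Fermat's rule for the sum of a convex function and a differentiable one. Convexity of `g` is
only needed along the segments that start at the minimizer `p`. -/
theorem neg_gradient_mem_subdiff [CompleteSpace H] {g : H → EReal} {φ : H → ℝ} {p φ' : H}
    (hb : ∀ x, g x ≠ ⊥) (hp : g p ≠ ⊤)
    (hconv : ∀ w, g w ≠ ⊤ → ∀ t : ℝ, 0 < t → t < 1 →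
      g (t • w + (1 - t) • p) ≤ (t : EReal) * g w + ((1 - t : ℝ) : EReal) * g p)
    (hmin : ∀ v, g p + (φ p : EReal) ≤ g v + (φ v : EReal)) (hφ : HasGradientAt φ φ' p) :
    -φ' ∈ subdiff g p := by
  intro w
  by_cases hw : g w = ⊤
  · rw [hw]; exact le_top
  have e1 := EReal.coe_toReal hp (hb p)
  have e2 := EReal.coe_toReal hw (hb w)
  set a := (g p).toReal
  set c := (g w).toReal
  have key : ∀ t : ℝ, 0 < t → t < 1 → a - c ≤ t⁻¹ • (φ (p + (0 + t) • (w - p)) -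
      φ (p + (0 : ℝ) • (w - p))) := by
    intro t ht ht1
    have h1 := hmin (t • w + (1 - t) • p)
    have h2 := h1.trans (add_le_add_left (hconv w hw t ht ht1) _)
    rw [← e1, ← e2] at h2
    norm_cast at h2
    have e3 : p + (0 + t) • (w - p) = t • w + (1 - t) • p := by module
    rw [e3, zero_smul, add_zero, smul_eq_mul, inv_mul_eq_div, le_div_iff₀ ht]
    nlinarith
  have hd : HasDerivAt (fun t : ℝ => φ (p + t • (w - p))) (inner ℝ φ' (w - p)) 0 := by
    have h1 : HasDerivAt (fun t : ℝ => p + t • (w - p)) (w - p) 0 := by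
      simpa using ((hasDerivAt_id (0 : ℝ)).smul_const (w - p)).const_add p
    have h2 : HasFDerivAt φ (InnerProductSpace.toDual ℝ H φ') (p + (0 : ℝ) • (w - p)) := by
      simpa using hφ.hasFDerivAt
    simpa [Function.comp_def] using h2.comp_hasDerivAt (0 : ℝ) h1
  have hlim := hd.tendsto_slope_zero_right
  have hle : a - c ≤ inner ℝ φ' (w - p) := by
    refine ge_of_tendsto hlim ?_
    filter_upwards [Ioo_mem_nhdsGT (show (0 : ℝ) < 1 by norm_num)] with t ht
    exact key t ht.1 ht.2
  rw [← e1, ← e2]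
  norm_cast
  rw [inner_neg_right, real_inner_comm]
  linarith

/-- Weierstrass' theorem for coercive lower semicontinuous functions. -/
theorem exists_forall_le_of_coercive [ProperSpace H] {g : H → EReal}
    (hl : LowerSemicontinuous g) (hc : Coercive g) (hp : ∃ x, g x < ⊤) : ∃ p, ∀ v, g p ≤ g v := by
  obtain ⟨x, hx⟩ := hp
  have h1 : ∀ᶠ v in Bornology.cobounded H, g x < g v := hc.eventually (lt_mem_nhds hx)
  obtain ⟨r, -, hr⟩ := (Metric.hasBasis_cobounded_compl_closedBall x).eventually_iff.1 h1
  have hr0 : 0 ≤ r := by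
    by_contra h
    have : x ∈ (Metric.closedBall x r)ᶜ := by
      rw [Metric.closedBall_eq_empty.2 (not_le.1 h)]; exact Set.notMem_empty x
    exact lt_irrefl _ (hr this)
  obtain ⟨p, -, hp⟩ := (hl.lowerSemicontinuousOn (Metric.closedBall x r)).exists_isMinOn
    ⟨x, Metric.mem_closedBall_self hr0⟩ (isCompact_closedBall x r)
  refine ⟨p, fun v => ?_⟩
  by_cases hv : v ∈ Metric.closedBall x r
  · exact hp hv
  · exact (hp (Metric.mem_closedBall_self hr0)).trans (hr hv).le

/-- A coercive function of class `Γ₀` plus a nonnegative continuous function attains its minimum,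
at a point where it is finite. -/
theorem Gamma0.exists_forall_add_le [ProperSpace H] {g : H → EReal} (hg : Gamma0 g)
    (hc : Coercive g) {φ : H → ℝ} (hφ : Continuous φ) (h0 : ∀ v, 0 ≤ φ v) :
    ∃ p, g p ≠ ⊤ ∧ ∀ v, g p + (φ p : EReal) ≤ g v + (φ v : EReal) := by
  have hp : ∃ x, g x + (φ x : EReal) < ⊤ := by
    obtain ⟨x, hx⟩ := hg.proper
    exact ⟨x, EReal.add_lt_top hx.ne (EReal.coe_ne_top _)⟩
  have hl : LowerSemicontinuous (fun v => g v + (φ v : EReal)) :=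
    hg.lsc.add' (continuous_coe_real_ereal.comp hφ).lowerSemicontinuous fun x =>
      EReal.continuousAt_add (Or.inr (EReal.coe_ne_bot _)) (Or.inr (EReal.coe_ne_top _))
  have hc' : Coercive (fun v => g v + (φ v : EReal)) := by
    refine tendsto_nhds_top_mono' hc fun v => ?_
    exact le_add_of_nonneg_right (EReal.coe_nonneg.2 (h0 v))
  obtain ⟨p, hmin⟩ := exists_forall_le_of_coercive hl hc' hp
  refine ⟨p, fun h => ?_, hmin⟩
  obtain ⟨x, hx⟩ := hp
  have := hmin x
  simp only [h, EReal.top_add_coe] at this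
  exact absurd (this.trans_lt hx) (lt_irrefl _)

theorem hasGradientAt_norm_sub_sq [CompleteSpace H] (c : ℝ) (x p : H) :
    HasGradientAt (fun v => c * ‖v - x‖ ^ 2) ((2 * c) • (p - x)) p := by
  rw [hasGradientAt_iff_hasFDerivAt]
  have h := (((hasFDerivAt_id p).sub_const x).norm_sq).const_mul c
  refine h.congr_fderiv ?_
  ext v
  simp
  ring

/-! ### Proximity operators and projections -/

section Prox

variable [FiniteDimensional ℝ H] {g : H → EReal} {γ : ℝ}

theorem prox_mem_subdiff (hg : Gamma0 g) (hc : Coercive g) (hγ : 0 < γ) (x : H) :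
    (1 / γ) • (x - prox γ g x) ∈ subdiff g (prox γ g x) := by
  have : CompleteSpace H := FiniteDimensional.complete ℝ H
  have : ProperSpace H := FiniteDimensional.proper ℝ H
  obtain ⟨p, -, hp⟩ := hg.exists_forall_add_le hc (φ := fun v => 1 / (2 * γ) * ‖v - x‖ ^ 2)
    (by fun_prop) (fun v => by positivity)
  have hP : IsProx γ g x (prox γ g x) := Classical.epsilon_spec (p := IsProx γ g x) ⟨p, hp⟩
  have htop : g (prox γ g x) ≠ ⊤ := by
    obtain ⟨y, hy⟩ := hg.proper
    intro h
    have := hP y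
    rw [h, EReal.top_add_coe] at this
    exact absurd (this.trans_lt (EReal.add_lt_top hy.ne (EReal.coe_ne_top _))) (lt_irrefl _)
  have h := neg_gradient_mem_subdiff (φ := fun v => 1 / (2 * γ) * ‖v - x‖ ^ 2) hg.ne_bot htop
    (fun w _ t h0 h1 => hg.convex w _ t h0 h1) hP (hasGradientAt_norm_sub_sq (1 / (2 * γ)) x _)
  convert h using 1
  rw [← smul_neg, neg_sub]
  congr 1
  field_simp

theorem eq_prox_iff (hg : Gamma0 g) (hc : Coercive g) (hγ : 0 < γ) (x p : H) :
    p = prox γ g x ↔ (1 / γ) • (x - p) ∈ subdiff g p := by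
  refine ⟨fun h => h ▸ prox_mem_subdiff hg hc hγ x, fun h => ?_⟩
  have h1 := subdiff_monotone hg.ne_bot hg.proper h (prox_mem_subdiff hg hc hγ x)
  set q := prox γ g x
  have e : (1 / γ) • (x - p) - (1 / γ) • (x - q) = -((1 / γ) • (p - q)) := by module
  rw [e, inner_neg_right, inner_smul_right, real_inner_self_eq_norm_sq] at h1
  have h2 : 0 < 1 / γ := by positivity
  have h3 : ‖p - q‖ ^ 2 ≤ 0 := by
    by_contra h4
    have := mul_pos h2 (not_le.1 h4)
    linarith
  have h5 : ‖p - q‖ = 0 := by nlinarith [norm_nonneg (p - q)]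
  exact sub_eq_zero.1 (norm_eq_zero.1 h5)

end Prox

/-- The subdifferential of the indicator function is the normal cone. -/
theorem mem_subdiff_indicatorFn {C : Set H} (hC : C.Nonempty) {k u : H} :
    u ∈ subdiff (indicatorFn C) k ↔ k ∈ C ∧ ∀ w ∈ C, inner ℝ (w - k) u ≤ 0 := by
  constructor
  · intro h
    have hk : k ∈ C := by
      by_contra hk
      exact ne_top_of_mem_subdiff (indicatorFn_proper hC) h (indicatorFn_of_notMem hk)
    refine ⟨hk, fun w hw => ?_⟩
    have := h w
    rw [indicatorFn_of_mem hk, indicatorFn_of_mem hw, add_zero] at this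
    exact_mod_cast this
  · rintro ⟨hk, h⟩ w
    by_cases hw : w ∈ C
    · rw [indicatorFn_of_mem hk, indicatorFn_of_mem hw, add_zero]
      exact_mod_cast h w hw
    · rw [indicatorFn_of_notMem hw]
      exact le_top

theorem metricProj_mem_subdiff [CompleteSpace H] {C : Set H} (hC : C.Nonempty) (hcl : IsClosed C)
    (hcv : Convex ℝ C) (x : H) :
    x - metricProj C x ∈ subdiff (indicatorFn C) (metricProj C x) := by
  have : Nonempty C := hC.to_subtype
  have hbdd : BddBelow (Set.range fun w : C => ‖x - w‖) :=
    ⟨0, by rintro _ ⟨w, rfl⟩; exact norm_nonneg _⟩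
  obtain ⟨p, hp, hpe⟩ := exists_norm_eq_iInf_of_complete_convex hC hcl.isComplete hcv x
  have hN : IsNearest C x (metricProj C x) := Classical.epsilon_spec (p := IsNearest C x)
    ⟨p, hp, fun u hu => hpe ▸ ciInf_le hbdd (⟨u, hu⟩ : C)⟩
  have heq : ‖x - metricProj C x‖ = ⨅ w : C, ‖x - w‖ :=
    le_antisymm (le_ciInf fun w => hN.2 w w.2) (ciInf_le hbdd ⟨_, hN.1⟩)
  rw [mem_subdiff_indicatorFn hC]
  refine ⟨hN.1, fun w hw => ?_⟩
  rw [real_inner_comm]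
  exact (norm_eq_iInf_iff_real_inner_le_zero hcv hN.1).1 heq w hw

theorem eq_metricProj_iff [CompleteSpace H] {C : Set H} (hC : C.Nonempty) (hcl : IsClosed C)
    (hcv : Convex ℝ C) (x p : H) :
    p = metricProj C x ↔ x - p ∈ subdiff (indicatorFn C) p := by
  refine ⟨fun h => h ▸ metricProj_mem_subdiff hC hcl hcv x, fun h => ?_⟩
  have h1 := subdiff_monotone (indicatorFn_ne_bot C) (indicatorFn_proper hC) h
    (metricProj_mem_subdiff hC hcl hcv x)
  set q := metricProj C x
  have e : (x - p) - (x - q) = -(p - q) := by abel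
  rw [e, inner_neg_right, real_inner_self_eq_norm_sq] at h1
  have h5 : ‖p - q‖ = 0 := by nlinarith [norm_nonneg (p - q)]
  exact sub_eq_zero.1 (norm_eq_zero.1 h5)

/-! ### Convex functions with Lipschitz gradient -/

section BaillonHaddad

variable [CompleteSpace H] {g : H → ℝ} {g' : H → H} {β : ℝ}

/-- The gradient inequality for differentiable convex functions. It is Fermat's rule for the sum
of `g` and `-g`, which is minimized everywhere. -/
theorem Gamma0.gradient_le (hg : Gamma0 fun x => (g x : EReal)) {x v : H}
    (hd : HasGradientAt g v x) (y : H) : g x + inner ℝ v (y - x) ≤ g y := by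
  have hd' : HasGradientAt (fun x => -g x) (-v) x := by
    rw [hasGradientAt_iff_hasFDerivAt, map_neg]
    exact hd.hasFDerivAt.neg
  have h := neg_gradient_mem_subdiff hg.ne_bot (EReal.coe_ne_top _)
    (fun w _ t h0 h1 => hg.convex w x t h0 h1)
    (fun v => by norm_cast; simp) hd' y
  norm_cast at h
  rw [neg_neg, real_inner_comm] at h
  linarith

/-- The descent lemma. -/
theorem le_add_sq_of_lipschitz_gradient (hd : ∀ x, HasGradientAt g (g' x) x)
    (hL : ∀ x y, ‖g' x - g' y‖ ≤ β * ‖x - y‖) (x y : H) :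
    g y ≤ g x + inner ℝ (g' x) (y - x) + β / 2 * ‖y - x‖ ^ 2 := by
  set h := y - x with hh
  have hder : ∀ t : ℝ, HasDerivAt (fun t : ℝ => g (x + t • h) - t * inner ℝ (g' x) h
      - β / 2 * ‖h‖ ^ 2 * t ^ 2)
      (inner ℝ (g' (x + t • h)) h - inner ℝ (g' x) h - β / 2 * ‖h‖ ^ 2 * (2 * t)) t := by
    intro t
    have h1 : HasDerivAt (fun t : ℝ => x + t • h) h t := by
      simpa using ((hasDerivAt_id t).smul_const h).const_add x
    have h2 : HasDerivAt (fun t : ℝ => g (x + t • h)) (inner ℝ (g' (x + t • h)) h) t := by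
      simpa [Function.comp_def] using (hd (x + t • h)).hasFDerivAt.comp_hasDerivAt t h1
    have h3 : HasDerivAt (fun t : ℝ => t * inner ℝ (g' x) h) (inner ℝ (g' x) h) t := by
      simpa using (hasDerivAt_id t).mul_const (inner ℝ (g' x) h)
    have h4 : HasDerivAt (fun t : ℝ => β / 2 * ‖h‖ ^ 2 * t ^ 2) (β / 2 * ‖h‖ ^ 2 * (2 * t)) t := by
      simpa using (hasDerivAt_pow 2 t).const_mul (β / 2 * ‖h‖ ^ 2)
    exact (h2.sub h3).sub h4
  have hanti := antitoneOn_of_deriv_nonpos (convex_Icc (0 : ℝ) 1)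
    (fun t _ => (hder t).continuousAt.continuousWithinAt)
    (fun t _ => (hder t).differentiableAt.differentiableWithinAt) (by
      intro t ht
      rw [interior_Icc] at ht
      rw [(hder t).deriv, ← inner_sub_left]
      have h1 := real_inner_le_norm (g' (x + t • h) - g' x) h
      have h2 := hL (x + t • h) x
      rw [add_sub_cancel_left, norm_smul, Real.norm_of_nonneg ht.1.le] at h2
      nlinarith [mul_le_mul_of_nonneg_right h2 (norm_nonneg h)])
  have := hanti (Set.left_mem_Icc.2 zero_le_one) (Set.right_mem_Icc.2 zero_le_one) zero_le_one
  simp only [zero_smul, one_smul, add_zero] at this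
  have e : x + h = y := by rw [hh]; abel
  rw [e] at this
  linarith

/-- The Baillon–Haddad theorem: a `β`-Lipschitz gradient of a convex function is
`1/β`-cocoercive. -/
theorem gradient_cocoercive (hβ : 0 < β) (hd : ∀ x, HasGradientAt g (g' x) x)
    (hc : ∀ x y, g x + inner ℝ (g' x) (y - x) ≤ g y)
    (hL : ∀ x y, ‖g' x - g' y‖ ≤ β * ‖x - y‖) (x y : H) :
    1 / β * ‖g' x - g' y‖ ^ 2 ≤ inner ℝ (g' x - g' y) (x - y) := by
  -- A gradient step from `y` for the function `g - ⟪g' x, ·⟫`, which is minimal at `x`.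
  have key : ∀ x y, g x + inner ℝ (g' x) (y - x) + 1 / (2 * β) * ‖g' x - g' y‖ ^ 2 ≤ g y := by
    intro x y
    set u := y - (1 / β) • (g' y - g' x) with hu
    have h1 := le_add_sq_of_lipschitz_gradient hd hL y u
    have h2 := hc x u
    have e1 : u - y = -((1 / β) • (g' y - g' x)) := by rw [hu]; abel
    have e2 : u - x = (y - x) - (1 / β) • (g' y - g' x) := by rw [hu]; abel
    rw [e1, norm_neg, norm_smul, Real.norm_of_nonneg (by positivity), inner_neg_right,
      inner_smul_right] at h1
    rw [e2, inner_sub_right, inner_smul_right] at h2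
    have e3 : inner ℝ (g' y) (g' y - g' x) - inner ℝ (g' x) (g' y - g' x)
        = ‖g' x - g' y‖ ^ 2 := by
      rw [← inner_sub_left, real_inner_self_eq_norm_sq, norm_sub_rev]
    rw [norm_sub_rev (g' y)] at h1
    have e4 : β / 2 * (1 / β * ‖g' x - g' y‖) ^ 2 = 1 / (2 * β) * ‖g' x - g' y‖ ^ 2 := by
      field_simp
    have e5 : 1 / β * ‖g' x - g' y‖ ^ 2 = 2 * (1 / (2 * β) * ‖g' x - g' y‖ ^ 2) := by
      field_simp
    rw [e4] at h1
    have e6 := congrArg (fun r => 1 / β * r) e3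
    simp only [mul_sub] at e6
    linarith
  have h1 := key x y
  have h2 := key y x
  rw [norm_sub_rev (g' y)] at h2
  have e5 : 1 / β * ‖g' x - g' y‖ ^ 2 = 2 * (1 / (2 * β) * ‖g' x - g' y‖ ^ 2) := by
    field_simp
  have e7 : inner ℝ (g' x) (y - x) = - inner ℝ (g' x) (x - y) := by
    rw [← inner_neg_right, neg_sub]
  rw [inner_sub_left]
  linarith

end BaillonHaddad

end ConvexAnalysis

/-! ### Averaged operators in the metric of a positive definite operator -/

section Averaged

variable {H : Type*} [NormedAddCommGroup H] [InnerProductSpace ℝ H] {P : H →ₗ[ℝ] H} {T : H → H}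

theorem PosDef.inner_self_nonneg (hP : PosDef P) (h : H) : 0 ≤ inner ℝ h (P h) := by
  rcases eq_or_ne h 0 with rfl | hh
  · simp
  · exact (hP.2 h hh).le

theorem normWrt_le_iff (hP : PosDef P) (x y : H) :
    normWrt P x ≤ normWrt P y ↔ inner ℝ x (P x) ≤ inner ℝ y (P y) :=
  Real.sqrt_le_sqrt_iff (hP.inner_self_nonneg y)

theorem PosDef.inner_sub_smul_self (hP : PosDef P) (c : ℝ) (x y : H) :
    inner ℝ (x - c • y) (P (x - c • y)) =
      inner ℝ x (P x) - 2 * c * inner ℝ x (P y) + c ^ 2 * inner ℝ y (P y) := by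
  have h : inner ℝ y (P x) = inner ℝ x (P y) := by rw [real_inner_comm, hP.1]
  simp only [map_sub, map_smul, inner_sub_left, inner_sub_right, inner_smul_left, inner_smul_right,
    h, RCLike.conj_to_real]
  ring

/-- Averagedness in terms of the displacement `(x - y) - (T x - T y)`. -/
theorem averagedWrt_of_inner_ge (hP : PosDef P) {α : ℝ} (h0 : 0 < α) (h1 : α < 1)
    (hT : ∀ x y, inner ℝ (x - y - (T x - T y)) (P (x - y - (T x - T y)))
      ≤ 2 * α * inner ℝ (x - y) (P (x - y - (T x - T y)))) : AveragedWrt P α T := by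
  refine ⟨⟨h0, h1⟩, fun x => x - α⁻¹ • (x - T x), fun x y => ?_, fun x => ?_⟩
  · rw [normWrt_le_iff hP, show x - α⁻¹ • (x - T x) - (y - α⁻¹ • (y - T y))
      = (x - y) - α⁻¹ • (x - y - (T x - T y)) by module, hP.inner_sub_smul_self]
    have h2 := mul_le_mul_of_nonneg_left (hT x y) (sq_nonneg α⁻¹)
    have h3 : α⁻¹ ^ 2 * (2 * α * inner ℝ (x - y) (P (x - y - (T x - T y))))
        = 2 * α⁻¹ * inner ℝ (x - y) (P (x - y - (T x - T y))) := by
      field_simp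
    linarith
  · rw [smul_sub, smul_inv_smul₀ h0.ne']
    module

theorem AveragedWrt.inner_le (hP : PosDef P) {α : ℝ} (hT : AveragedWrt P α T) (x y : H) :
    inner ℝ (x - y - (T x - T y)) (P (x - y - (T x - T y)))
      ≤ 2 * α * inner ℝ (x - y) (P (x - y - (T x - T y))) := by
  obtain ⟨⟨h0, -⟩, N, hN, hTN⟩ := hT
  have h2 := (normWrt_le_iff hP _ _).1 (hN x y)
  have e : N x - N y = (x - y) - (1 : ℝ) • (x - y - (N x - N y)) := by module
  rw [e, hP.inner_sub_smul_self] at h2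
  have e' : x - y - (T x - T y) = α • (x - y - (N x - N y)) := by
    rw [hTN x, hTN y]
    module
  rw [e', map_smul, inner_smul_left, inner_smul_right, inner_smul_right, RCLike.conj_to_real]
  nlinarith [mul_pos h0 h0]

/-- The displacement estimate that drives the convergence of the iterates. -/
theorem AveragedWrt.inner_image_le (hP : PosDef P) {α : ℝ} (hT : AveragedWrt P α T) (x y : H) :
    inner ℝ (T x - T y) (P (T x - T y)) + (1 / α - 1) *
      inner ℝ (x - y - (T x - T y)) (P (x - y - (T x - T y))) ≤ inner ℝ (x - y) (P (x - y)) := by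
  have h1 := hT.inner_le hP x y
  have h0 := hT.1.1
  have e : T x - T y = (x - y) - (1 : ℝ) • (x - y - (T x - T y)) := by module
  have h2 := hP.inner_sub_smul_self 1 (x - y) (x - y - (T x - T y))
  rw [← e] at h2
  rw [h2]
  have h3 := mul_le_mul_of_nonneg_left h1 (one_div_pos.2 h0).le
  have h4 : 1 / α * (2 * α * inner ℝ (x - y) (P (x - y - (T x - T y))))
      = 2 * inner ℝ (x - y) (P (x - y - (T x - T y))) := by
    field_simp
  linarith

variable [FiniteDimensional ℝ H]

theorem PosDef.exists_mul_norm_sq_le (hP : PosDef P) :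
    ∃ c : ℝ, 0 < c ∧ ∀ h, c * ‖h‖ ^ 2 ≤ inner ℝ h (P h) := by
  have : ProperSpace H := FiniteDimensional.proper ℝ H
  rcases subsingleton_or_nontrivial H with hs | hn
  · exact ⟨1, one_pos, fun h => by simp [Subsingleton.elim h 0]⟩
  have hcont : Continuous fun h : H => inner ℝ h (P h) :=
    continuous_id.inner P.continuous_of_finiteDimensional
  obtain ⟨u, hu, hmin⟩ := (isCompact_sphere (0 : H) 1).exists_isMinOn
    (NormedSpace.sphere_nonempty.2 zero_le_one) hcont.continuousOn
  have hu0 : u ≠ 0 := by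
    rintro rfl
    simp at hu
  refine ⟨_, hP.2 u hu0, fun h => ?_⟩
  rcases eq_or_ne h 0 with rfl | hh
  · simp
  have hn : 0 < ‖h‖ := norm_pos_iff.2 hh
  have h1 := hmin (show ‖h‖⁻¹ • h ∈ Metric.sphere (0 : H) 1 by
    simp [norm_smul, inv_mul_cancel₀ hn.ne'])
  simp only [Set.mem_ofPred_eq, map_smul, inner_smul_left, inner_smul_right,
    RCLike.conj_to_real] at h1
  calc _ ≤ ‖h‖⁻¹ * (‖h‖⁻¹ * inner ℝ h (P h)) * ‖h‖ ^ 2 := by gcongr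
    _ = inner ℝ h (P h) := by field_simp

theorem PosDef.tendsto_zero (hP : PosDef P) {ι : Type*} {l : Filter ι} {h : ι → H}
    (hh : Tendsto (fun k => inner ℝ (h k) (P (h k))) l (𝓝 0)) : Tendsto h l (𝓝 0) := by
  obtain ⟨c, hc, hle⟩ := hP.exists_mul_norm_sq_le
  have h1 : Tendsto (fun k => ‖h k‖ ^ 2) l (𝓝 0) := by
    refine squeeze_zero (fun k => by positivity) (fun k => ?_) (by simpa using hh.const_mul c⁻¹)
    rw [inv_mul_eq_div, le_div_iff₀ hc, mul_comm]
    exact hle _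
  rw [tendsto_zero_iff_norm_tendsto_zero]
  simpa [Real.sqrt_sq] using h1.sqrt

/-- The Krasnosel'skii–Mann theorem in finite dimension: the iterates are Fejér monotone with
respect to the fixed points and asymptotically regular, hence every cluster point is a fixed point
and the whole sequence converges to it. -/
theorem AveragedWrt.exists_tendsto (hP : PosDef P) {α : ℝ} (hT : AveragedWrt P α T)
    (hfix : ∃ y, y = T y) {h : ℕ → H} (hh : ∀ k, h (k + 1) = T (h k)) :
    ∃ y, y = T y ∧ Tendsto h atTop (𝓝 y) := by
  have hc : 0 < 1 / α - 1 := by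
    rw [sub_pos, lt_div_iff₀ hT.1.1]
    linarith [hT.1.2]
  have hstep : ∀ y, y = T y → ∀ k, inner ℝ (h (k + 1) - y) (P (h (k + 1) - y)) + (1 / α - 1) *
      inner ℝ (h k - h (k + 1)) (P (h k - h (k + 1))) ≤ inner ℝ (h k - y) (P (h k - y)) := by
    intro y hy k
    have := hT.inner_image_le hP (h k) y
    rw [← hh, ← hy] at this
    rwa [show h k - y - (h (k + 1) - y) = h k - h (k + 1) by abel] at this
  have hanti : ∀ y, y = T y → Antitone fun k => inner ℝ (h k - y) (P (h k - y)) := fun y hy =>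
    antitone_nat_of_succ_le fun k => by
      have := hstep y hy k
      have := mul_nonneg hc.le (hP.inner_self_nonneg (h k - h (k + 1)))
      linarith
  have hconv : ∀ y, y = T y →
      ∃ a, Tendsto (fun k => inner ℝ (h k - y) (P (h k - y))) atTop (𝓝 a) := fun y hy =>
    ⟨_, tendsto_atTop_ciInf (hanti y hy)
      ⟨0, by rintro _ ⟨k, rfl⟩; exact hP.inner_self_nonneg _⟩⟩
  obtain ⟨y, hy⟩ := hfix
  have hreg : Tendsto (fun k => h k - h (k + 1)) atTop (𝓝 0) := by
    refine hP.tendsto_zero ?_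
    obtain ⟨a, ha⟩ := hconv y hy
    have h1 := (ha.sub (ha.comp (tendsto_add_atTop_nat 1))).const_mul (1 / α - 1)⁻¹
    rw [sub_self, mul_zero] at h1
    refine squeeze_zero (fun k => hP.inner_self_nonneg _) (fun k => ?_) h1
    have := hstep y hy k
    rw [inv_mul_eq_div, le_div_iff₀ hc]
    simp only [Function.comp_apply]
    linarith
  have hbdd : Bornology.IsBounded (Set.range h) := by
    obtain ⟨c, hc, hle⟩ := hP.exists_mul_norm_sq_le
    set R := inner ℝ (h 0 - y) (P (h 0 - y)) / c
    refine (Metric.isBounded_iff_subset_closedBall y).2 ⟨√R, ?_⟩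
    rintro _ ⟨k, rfl⟩
    rw [Metric.mem_closedBall, dist_eq_norm]
    refine Real.le_sqrt_of_sq_le ?_
    rw [le_div_iff₀ hc, mul_comm]
    exact (hle _).trans (hanti y hy (Nat.zero_le k))
  have : ProperSpace H := FiniteDimensional.proper ℝ H
  obtain ⟨y', -, φ, hφ, hlim⟩ := tendsto_subseq_of_bounded hbdd (fun k => Set.mem_range_self k)
  have hsub : Tendsto (fun k => inner ℝ (h (φ k) - y') (P (h (φ k) - y'))) atTop (𝓝 0) := by
    have h1 : Tendsto (fun k => h (φ k) - y') atTop (𝓝 0) := by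
      simpa using hlim.sub_const y'
    have hcont : Continuous fun h : H => inner ℝ h (P h) :=
      continuous_id.inner P.continuous_of_finiteDimensional
    exact (hcont.tendsto' 0 0 (by simp)).comp h1
  have hy' : y' = T y' := by
    have h1 : Tendsto (fun k => h (φ k + 1)) atTop (𝓝 y') := by
      simpa using hlim.sub (hreg.comp hφ.tendsto_atTop)
    have h2 : Tendsto (fun k => h (φ k + 1) - T y') atTop (𝓝 0) := by
      refine hP.tendsto_zero (squeeze_zero (fun k => hP.inner_self_nonneg _) (fun k => ?_) hsub)
      have := hT.inner_image_le hP (h (φ k)) y'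
      rw [hh]
      have := mul_nonneg hc.le
        (hP.inner_self_nonneg (h (φ k) - y' - (T (h (φ k)) - T y')))
      linarith
    have h3 : Tendsto (fun k => h (φ k + 1)) atTop (𝓝 (T y')) := by
      simpa using h2.add_const (T y')
    exact tendsto_nhds_unique h1 h3
  refine ⟨y', hy', ?_⟩
  have h1 := hP.tendsto_zero
    ((tendsto_iff_tendsto_subseq_of_antitone (hanti y' hy') hφ.tendsto_atTop).2 hsub)
  simpa using h1.add_const y'

end Averaged

/-! ### The product space -/

theorem Prod4.ext {X Z W : Type*} {h h' : Prod4 X Z W} (h1 : h.fst = h'.fst)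
    (h2 : h.snd.fst = h'.snd.fst) (h3 : h.snd.snd.fst = h'.snd.snd.fst)
    (h4 : h.snd.snd.snd = h'.snd.snd.snd) : h = h' := by
  change mk4 h.fst h.snd.fst h.snd.snd.fst h.snd.snd.snd = h'
  rw [h1, h2, h3, h4]
  rfl

theorem Prod4.inner_def {X Z W : Type*} [NormedAddCommGroup X] [InnerProductSpace ℝ X]
    [NormedAddCommGroup Z] [InnerProductSpace ℝ Z] [NormedAddCommGroup W] [InnerProductSpace ℝ W]
    (h h' : Prod4 X Z W) : inner ℝ h h' = inner ℝ h.fst h'.fst +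
    (inner ℝ h.snd.fst h'.snd.fst + (inner ℝ h.snd.snd.fst h'.snd.snd.fst +
      inner ℝ h.snd.snd.snd h'.snd.snd.snd)) := by
  rw [WithLp.prod_inner_apply, WithLp.prod_inner_apply, WithLp.prod_inner_apply]
  rfl

open ContinuousLinearMap (adjoint)

/-! ### The envelope and the cost function -/

namespace Model

variable {X Y Z Zt W : Type*}
  [NormedAddCommGroup X] [InnerProductSpace ℝ X] [CompleteSpace X]
  [NormedAddCommGroup Y] [InnerProductSpace ℝ Y]
  [NormedAddCommGroup Z] [InnerProductSpace ℝ Z] [CompleteSpace Z]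
  [NormedAddCommGroup Zt] [InnerProductSpace ℝ Zt] [CompleteSpace Zt]
  [NormedAddCommGroup W] [InnerProductSpace ℝ W] [CompleteSpace W]
  (M : Model X Y Z Zt W)

theorem C_nonempty : M.C.Nonempty :=
  let ⟨x, hx⟩ := M.feasible
  ⟨M.K x, hx.2⟩

theorem inner_BB (u v : Z) : inner ℝ (M.BB u) v = inner ℝ (M.B u) (M.B v) := by
  simp [BB, ContinuousLinearMap.adjoint_inner_left]

theorem inner_BB_comm (u v : Z) : inner ℝ (M.BB u) v = inner ℝ u (M.BB v) := by
  rw [inner_BB, real_inner_comm _ u, inner_BB, real_inner_comm]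

theorem hasGradientAt_half_norm_B_sq {V : Type*} [NormedAddCommGroup V] [InnerProductSpace ℝ V]
    [CompleteSpace V] (c : ℝ) (E : V →L[ℝ] Z) (u : Z) (x : V) :
    HasGradientAt (fun y => c / 2 * ‖M.B (u - E y)‖ ^ 2)
      (-(c • adjoint E (M.BB (u - E x)))) x := by
  rw [hasGradientAt_iff_hasFDerivAt]
  have h1 : HasFDerivAt (fun y => M.B (u - E y)) (M.B ∘L (-E)) x :=
    M.B.hasFDerivAt.comp x (E.hasFDerivAt.const_sub u)
  refine (h1.norm_sq.const_mul (c / 2)).congr_fderiv ?_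
  ext y
  simp only [smul_apply, ContinuousLinearMap.comp_apply, innerSL_apply_apply,
    InnerProductSpace.toDual_apply_apply, neg_apply, map_neg,
    smul_eq_mul, inner_smul_left, ContinuousLinearMap.adjoint_inner_left, inner_BB]
  simp
  ring

/-- The generalized Moreau envelope `u ↦ min_v [Ψ(v) + ‖B(u - v)‖² / 2]` that `Ψ_B` subtracts
from `Ψ`. -/
def envelope (u : Z) : EReal :=
  ⨅ v : Z, (M.Ψ v + ((1 / 2 * ‖M.B (u - v)‖ ^ 2 : ℝ) : EReal))

/-- Fermat's rule for the minimization in the definition of the envelope; the inclusion also implies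
that `v` is a minimizer, see `envelope_eq`. -/
theorem exists_envelope_point [FiniteDimensional ℝ Z] (u : Z) :
    ∃ v, M.BB (u - v) ∈ subdiff M.Ψ v := by
  have : ProperSpace Z := FiniteDimensional.proper ℝ Z
  obtain ⟨v, hv, hmin⟩ := M.Ψ_gamma0.exists_forall_add_le M.Ψ_coercive
    (φ := fun v => 1 / 2 * ‖M.B (u - v)‖ ^ 2) (by fun_prop) (fun v => by positivity)
  refine ⟨v, ?_⟩
  have hgrad := M.hasGradientAt_half_norm_B_sq 1 (.id ℝ Z) u v
  have h := neg_gradient_mem_subdiff M.Ψ_gamma0.ne_bot hv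
    (fun w _ t h0 h1 => M.Ψ_gamma0.convex w _ t h0 h1) hmin hgrad
  simpa [ContinuousLinearMap.adjoint_id] using h

section Envelope

variable {M} {u v : Z} (h : M.BB (u - v) ∈ subdiff M.Ψ v)
include h

theorem coe_toReal_Ψ : ((M.Ψ v).toReal : EReal) = M.Ψ v :=
  EReal.coe_toReal (ne_top_of_mem_subdiff M.Ψ_gamma0.proper h) (M.Ψ_gamma0.ne_bot v)

/-- `B*B(u - v)` is a subgradient of the envelope at `u`. -/
theorem envelope_ge (u' : Z) :
    (((M.Ψ v).toReal + 1 / 2 * ‖M.B (u - v)‖ ^ 2 + inner ℝ (M.BB (u - v)) (u' - u) : ℝ) : EReal)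
      ≤ M.envelope u' := by
  refine le_iInf fun v' => ?_
  have h1 := h v'
  rw [← coe_toReal_Ψ h] at h1
  refine le_trans ?_ (add_le_add_left h1 _)
  norm_cast
  rw [real_inner_comm _ (v' - v), inner_BB, inner_BB, map_sub M.B v' v, map_sub M.B u' u,
    show M.B (u' - v') = M.B (u - v) + (M.B u' - M.B u - (M.B v' - M.B v)) by
      simp only [map_sub]; abel, norm_add_sq_real, inner_sub_right _ (M.B u' - M.B u)]
  nlinarith [sq_nonneg ‖M.B u' - M.B u - (M.B v' - M.B v)‖]

theorem envelope_le (u' : Z) :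
    M.envelope u' ≤ (((M.Ψ v).toReal + 1 / 2 * ‖M.B (u' - v)‖ ^ 2 : ℝ) : EReal) := by
  refine (iInf_le _ v).trans ?_
  rw [EReal.coe_add, coe_toReal_Ψ h]

theorem envelope_eq :
    M.envelope u = (((M.Ψ v).toReal + 1 / 2 * ‖M.B (u - v)‖ ^ 2 : ℝ) : EReal) := by
  refine le_antisymm (envelope_le h u) ?_
  simpa using envelope_ge h u

end Envelope

theorem J_eq {x : X} {p e : ℝ} (hp : M.Ψ (M.L x) = p) (he : M.envelope (M.L x) = e) :
    M.J x = ((M.f (M.A x) + M.μ * (p - e) : ℝ) : EReal) := by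
  unfold J gme
  rw [hp]
  change _ + _ * (_ - M.envelope _) = _
  rw [he]
  norm_cast

theorem J_eq_top {x : X} {e : ℝ} (hp : M.Ψ (M.L x) = ⊤) (he : M.envelope (M.L x) = e) :
    M.J x = ⊤ := by
  unfold J gme
  rw [hp]
  change _ + _ * (_ - M.envelope _) = _
  rw [he, EReal.top_sub_coe, EReal.coe_mul_top_of_pos M.μ_pos, EReal.coe_add_top]

theorem hasGradientAt_d (x : X) : HasGradientAt M.d (gradient M.d x) x := by
  refine DifferentiableAt.hasGradientAt ?_
  have h1 : Differentiable ℝ M.f := M.f_contDiff.differentiable one_ne_zero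
  have h2 : Differentiable ℝ fun x => ‖M.B (M.L x)‖ ^ 2 := by
    have : Differentiable ℝ fun x => M.B (M.L x) := by fun_prop
    exact this.norm_sq ℝ
  unfold d
  fun_prop

/-! ### The optimality system and the solution set -/

/-- The optimality system in the primal variable `x`, the envelope point `v`, and the
multipliers `w` and `z` of `Ψ ∘ L` and of the constraint. -/
structure IsKKT (x : X) (v w : Z) (z : W) : Prop where
  stationary : gradient M.d x + M.μ • adjoint M.L (M.BB v) + M.μ • adjoint M.L w
    + M.μ • adjoint M.K z = 0
  envelope : M.BB (M.L x - v) ∈ subdiff M.Ψ v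
  regularizer : w ∈ subdiff M.Ψ (M.L x)
  constraint : z ∈ subdiff (indicatorFn M.C) (M.K x)

variable {M}

/-- Sufficiency: the optimality system provides an affine minorant for each summand of `J`. -/
theorem IsKKT.mem_solutionSet [FiniteDimensional ℝ Z] {β : ℝ} (hM : M.Assumptions β) {x : X}
    {v w : Z} {z : W} (h : M.IsKKT x v w z) : x ∈ M.solutionSet := by
  obtain ⟨hx, hz⟩ := (mem_subdiff_indicatorFn M.C_nonempty).1 h.constraint
  refine ⟨hx, fun y hy => ?_⟩
  obtain ⟨v', hv'⟩ := M.exists_envelope_point (M.L y)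
  have hw := h.regularizer (M.L y)
  have ex := EReal.coe_toReal (ne_top_of_mem_subdiff M.Ψ_gamma0.proper h.regularizer)
    (M.Ψ_gamma0.ne_bot _)
  by_cases hy' : M.Ψ (M.L y) = ⊤
  · rw [M.J_eq_top hy' (envelope_eq hv')]
    exact le_top
  have ey := EReal.coe_toReal hy' (M.Ψ_gamma0.ne_bot _)
  obtain ⟨e, hee⟩ : ∃ e : ℝ, M.envelope (M.L y) = e := ⟨_, envelope_eq hv'⟩
  have he := envelope_le h.envelope (M.L y)
  rw [M.J_eq ex.symm (envelope_eq h.envelope), M.J_eq ey.symm hee]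
  rw [hee] at he
  rw [← ex, ← ey] at hw
  norm_cast at hw he ⊢
  have hd := hM.overall_convexity.gradient_le (M.hasGradientAt_d x) y
  have hz := hz _ hy
  have hst := congrArg (fun g => inner ℝ g (y - x)) h.stationary
  simp only [inner_add_left, inner_smul_left, ContinuousLinearMap.adjoint_inner_left,
    inner_zero_left, map_sub, RCLike.conj_to_real, inner_BB] at hst
  rw [real_inner_comm] at hw hz
  rw [map_sub, norm_sub_sq_real] at he ⊢
  simp only [show ∀ y, M.d y = M.f (M.A y) - M.μ / 2 * ‖M.B (M.L y)‖ ^ 2 from fun _ => rfl] at hd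
  rw [inner_sub_right (M.B v), real_inner_comm (M.B (M.L y)) (M.B v),
    real_inner_comm (M.B (M.L x)) (M.B v)] at hst
  have hμ := M.μ_pos
  nlinarith [mul_le_mul_of_nonneg_left he hμ.le, mul_le_mul_of_nonneg_left hw hμ.le,
    mul_nonpos_of_nonneg_of_nonpos hμ.le hz]

/-- Necessity. Replacing the subtracted envelope by its affine minorant at `L x` turns `J` into a
function that still has `x` as a constrained minimizer and is the sum of a differentiable and a
convex function, so that Fermat's rule and the sum rule for subdifferentials apply. -/
theorem exists_isKKT_of_mem_solutionSet [FiniteDimensional ℝ Z] {β : ℝ} (hM : M.Assumptions β)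
    {x : X} (hx : x ∈ M.solutionSet) : ∃ v w z, M.IsKKT x v w z := by
  obtain ⟨hxC, hmin⟩ := hx
  obtain ⟨v, hv⟩ := M.exists_envelope_point (M.L x)
  have hμ := M.μ_pos
  have hxtop : M.Ψ (M.L x) ≠ ⊤ := by
    intro h
    obtain ⟨y, hy, hyC⟩ := M.feasible
    obtain ⟨v', hv'⟩ := M.exists_envelope_point (M.L y)
    have := hmin y hyC
    rw [M.J_eq_top h (envelope_eq hv), M.J_eq (EReal.coe_toReal hy.ne (M.Ψ_gamma0.ne_bot _)).symm
      (envelope_eq hv')] at this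
    exact EReal.coe_ne_top _ (top_le_iff.1 this)
  have ex := EReal.coe_toReal hxtop (M.Ψ_gamma0.ne_bot _)
  set G : X → EReal := fun x' => (M.μ : EReal) * M.Ψ (M.L x') + indicatorFn M.C (M.K x') with hG
  have hGtop : ∀ y, G y ≠ ⊤ → M.K y ∈ M.C ∧ M.Ψ (M.L y) ≠ ⊤ := by
    intro y hy
    have hyb : (M.μ : EReal) * M.Ψ (M.L y) ≠ ⊥ := by
      by_cases ht : M.Ψ (M.L y) = ⊤
      · rw [ht, EReal.coe_mul_top_of_pos hμ]; exact top_ne_bot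
      · rw [← EReal.coe_toReal ht (M.Ψ_gamma0.ne_bot _)]
        exact EReal.coe_ne_bot _
    constructor
    · by_contra hyC
      exact hy (by simp only [hG]; rw [indicatorFn_of_notMem hyC, EReal.add_top_of_ne_bot hyb])
    · intro ht
      refine hy ?_
      simp only [hG]
      rw [ht, EReal.coe_mul_top_of_pos hμ, EReal.top_add_of_ne_bot (indicatorFn_ne_bot _ _)]
  have hGeq : ∀ y, M.K y ∈ M.C → G y = (M.μ : EReal) * M.Ψ (M.L y) := fun y hy => by
    simp only [hG]
    rw [indicatorFn_of_mem hy, add_zero]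
  have hGbot : ∀ y, G y ≠ ⊥ := by
    intro y
    by_cases hy : G y = ⊤
    · rw [hy]; exact top_ne_bot
    obtain ⟨hyC, hyt⟩ := hGtop y hy
    rw [hGeq y hyC, ← EReal.coe_toReal hyt (M.Ψ_gamma0.ne_bot _)]
    exact EReal.coe_ne_bot _
  -- The smooth part `f ∘ A - μ ⟪B*B(L x - v), L ·⟫` of the majorant, with `f ∘ A` written as
  -- `𝔡 + μ ‖B L ·‖² / 2` since the optimality system is in terms of `∇𝔡`.
  have hφ : HasGradientAt (fun y => M.d y + (M.μ / 2 * ‖M.B (0 - M.L y)‖ ^ 2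
      - M.μ * inner ℝ (M.BB (M.L x - v)) (M.L y)))
      (gradient M.d x + M.μ • adjoint M.L (M.BB v)) x := by
    have h1 := (M.hasGradientAt_d x).hasFDerivAt
    have h2 := (M.hasGradientAt_half_norm_B_sq M.μ M.L 0 x).hasFDerivAt
    have h3 : HasFDerivAt (fun y => M.μ * inner ℝ (M.BB (M.L x - v)) (M.L y))
        (M.μ • (innerSL ℝ (M.BB (M.L x - v)) ∘L M.L)) x :=
      ((innerSL ℝ (M.BB (M.L x - v)) ∘L M.L).hasFDerivAt).const_mul M.μ
    rw [hasGradientAt_iff_hasFDerivAt]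
    refine (h1.add (h2.sub h3)).congr_fderiv ?_
    ext y
    simp [ContinuousLinearMap.adjoint_inner_left]
    ring
  have hmem := neg_gradient_mem_subdiff (g := G) hGbot
    (by rw [hGeq x hxC, ← ex]; exact EReal.coe_ne_top _) ?_ ?_ hφ
  · rw [hG, hM.subdiff_rule] at hmem
    obtain ⟨w, hw, z, hz, hwz⟩ := hmem
    -- The sum rule has no factor `μ` in front of the normal vector, and the normal cone is a cone.
    refine ⟨v, w, M.μ⁻¹ • z, ⟨?_, hv, hw, ?_⟩⟩
    · rw [map_smul, smul_inv_smul₀ hμ.ne', add_assoc, ← hwz]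
      abel
    · rw [mem_subdiff_indicatorFn M.C_nonempty] at hz ⊢
      refine ⟨hz.1, fun u hu => ?_⟩
      rw [inner_smul_right]
      exact mul_nonpos_of_nonneg_of_nonpos (inv_nonneg.2 hμ.le) (hz.2 u hu)
  · intro y hy t h0 h1
    obtain ⟨hyC, hyt⟩ := hGtop y hy
    have ey := EReal.coe_toReal hyt (M.Ψ_gamma0.ne_bot _)
    have hC : M.K (t • y + (1 - t) • x) ∈ M.C := by
      rw [map_add, map_smul, map_smul]
      exact M.C_convex hyC hxC h0.le (by linarith) (by ring)
    have hc := M.Ψ_gamma0.convex (M.L y) (M.L x) t h0 h1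
    rw [hGeq _ hC, hGeq _ hyC, hGeq _ hxC, map_add, map_smul, map_smul]
    rw [← ex, ← ey] at hc ⊢
    have hct : M.Ψ (t • M.L y + (1 - t) • M.L x) ≠ ⊤ :=
      fun h => by rw [h] at hc; exact absurd hc (by norm_cast)
    rw [← EReal.coe_toReal hct (M.Ψ_gamma0.ne_bot _)] at hc ⊢
    norm_cast at hc ⊢
    nlinarith
  · intro y
    by_cases hy : G y = ⊤
    · rw [hy, EReal.top_add_coe]; exact le_top
    obtain ⟨hyC, hyt⟩ := hGtop y hy
    have ey := EReal.coe_toReal hyt (M.Ψ_gamma0.ne_bot _)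
    obtain ⟨v', hv'⟩ := M.exists_envelope_point (M.L y)
    have h1 := hmin y hyC
    have h2 := envelope_ge hv (M.L y)
    rw [envelope_eq hv'] at h2
    rw [M.J_eq ex.symm (envelope_eq hv), M.J_eq ey.symm (envelope_eq hv')] at h1
    rw [hGeq _ hyC, hGeq _ hxC, ← ex, ← ey]
    norm_cast at h1 h2 ⊢
    rw [inner_sub_right] at h2
    simp only [d, zero_sub, map_neg, norm_neg]
    nlinarith [mul_le_mul_of_nonneg_left h2 hμ.le]

/-! ### Fixed points of `T` -/

theorem T_fst (σ τ : ℝ) (h : Prod4 X Z W) : (M.T σ τ h).fst = M.xi σ h := rfl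

theorem T_snd_fst (σ τ : ℝ) (h : Prod4 X Z W) : (M.T σ τ h).snd.fst =
    prox (M.μ / τ) M.Ψ ((2 * M.μ / τ) • M.BB (M.L (M.xi σ h)) - (M.μ / τ) • M.BB (M.L h.fst)
      + (h.snd.fst - (M.μ / τ) • M.BB h.snd.fst)) := rfl

theorem T_snd_snd_fst (σ τ : ℝ) (h : Prod4 X Z W) : (M.T σ τ h).snd.snd.fst =
    ((2 : ℝ) • M.L (M.xi σ h) - M.L h.fst + h.snd.snd.fst)
      - prox 1 M.Ψ ((2 : ℝ) • M.L (M.xi σ h) - M.L h.fst + h.snd.snd.fst) := rfl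

theorem T_snd_snd_snd (σ τ : ℝ) (h : Prod4 X Z W) : (M.T σ τ h).snd.snd.snd =
    ((2 : ℝ) • M.K (M.xi σ h) - M.K h.fst + h.snd.snd.snd)
      - metricProj M.C ((2 : ℝ) • M.K (M.xi σ h) - M.K h.fst + h.snd.snd.snd) := rfl

/-- The fixed points of `T` are the solutions of the optimality system. -/
theorem mem_fixT_iff [FiniteDimensional ℝ Z] {σ τ : ℝ} (hσ : 0 < σ) (hτ : 0 < τ)
    (h : Prod4 X Z W) :
    h ∈ M.fixT σ τ ↔ M.IsKKT h.fst h.snd.fst h.snd.snd.fst h.snd.snd.snd := by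
  have hμ := M.μ_pos
  have e0 : h ∈ M.fixT σ τ ↔ h.fst = (M.T σ τ h).fst ∧ h.snd.fst = (M.T σ τ h).snd.fst ∧
      h.snd.snd.fst = (M.T σ τ h).snd.snd.fst ∧ h.snd.snd.snd = (M.T σ τ h).snd.snd.snd := by
    constructor
    · intro e
      rw [← show h = M.T σ τ h from e]
      exact ⟨rfl, rfl, rfl, rfl⟩
    · rintro ⟨e1, e2, e3, e4⟩
      exact Prod4.ext e1 e2 e3 e4
  have h1 : h.fst = M.xi σ h ↔ gradient M.d h.fst + M.μ • adjoint M.L (M.BB h.snd.fst)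
      + M.μ • adjoint M.L h.snd.snd.fst + M.μ • adjoint M.K h.snd.snd.snd = 0 := by
    have e : M.xi σ h = h.fst - (1 / σ) • (gradient M.d h.fst
        + M.μ • adjoint M.L (M.BB h.snd.fst) + M.μ • adjoint M.L h.snd.snd.fst
        + M.μ • adjoint M.K h.snd.snd.snd) := by
      unfold xi
      module
    rw [e, eq_comm, sub_eq_self, smul_eq_zero_iff_right (by positivity)]
  have h2 : h.fst = M.xi σ h → (h.snd.fst = (M.T σ τ h).snd.fst ↔
      M.BB (M.L h.fst - h.snd.fst) ∈ subdiff M.Ψ h.snd.fst) := by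
    intro e
    rw [T_snd_fst, ← e, eq_prox_iff M.Ψ_gamma0 M.Ψ_coercive (by positivity)]
    congr! 1
    have e' : (2 * M.μ / τ) • M.BB (M.L h.fst) - (M.μ / τ) • M.BB (M.L h.fst)
        + (h.snd.fst - (M.μ / τ) • M.BB h.snd.fst) - h.snd.fst
        = (M.μ / τ) • M.BB (M.L h.fst - h.snd.fst) := by
      rw [map_sub]
      module
    rw [e', smul_smul, one_div, inv_mul_cancel₀ (by positivity), one_smul]
  have h3 : h.fst = M.xi σ h → (h.snd.snd.fst = (M.T σ τ h).snd.snd.fst ↔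
      h.snd.snd.fst ∈ subdiff M.Ψ (M.L h.fst)) := by
    intro e
    have e' : (2 : ℝ) • M.L h.fst - M.L h.fst + h.snd.snd.fst = M.L h.fst + h.snd.snd.fst := by
      module
    rw [T_snd_snd_fst, ← e, e', eq_sub_iff_add_eq', ← eq_sub_iff_add_eq, add_sub_cancel_right,
      eq_comm, eq_prox_iff M.Ψ_gamma0 M.Ψ_coercive one_pos, add_sub_cancel_left, one_div_one, one_smul]
  have h4 : h.fst = M.xi σ h → (h.snd.snd.snd = (M.T σ τ h).snd.snd.snd ↔
      h.snd.snd.snd ∈ subdiff (indicatorFn M.C) (M.K h.fst)) := by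
    intro e
    have e' : (2 : ℝ) • M.K h.fst - M.K h.fst + h.snd.snd.snd = M.K h.fst + h.snd.snd.snd := by
      module
    rw [T_snd_snd_snd, ← e, e', eq_sub_iff_add_eq', ← eq_sub_iff_add_eq, add_sub_cancel_right,
      eq_comm, eq_metricProj_iff M.C_nonempty M.C_closed M.C_convex, add_sub_cancel_left]
  rw [e0]
  constructor
  · rintro ⟨a, b, c, d⟩
    exact ⟨h1.1 a, (h2 a).1 b, (h3 a).1 c, (h4 a).1 d⟩
  · rintro ⟨a, b, c, d⟩
    have a' := h1.2 a
    exact ⟨a', (h2 a').2 b, (h3 a').2 c, (h4 a').2 d⟩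

theorem solutionSet_eq [FiniteDimensional ℝ Z] {β : ℝ} (hM : M.Assumptions β) {σ τ : ℝ}
    (hσ : 0 < σ) (hτ : 0 < τ) : M.solutionSet = Xi '' M.fixT σ τ := by
  ext x
  constructor
  · intro hx
    obtain ⟨v, w, z, h⟩ := exists_isKKT_of_mem_solutionSet hM hx
    exact ⟨mk4 x v w z, (mem_fixT_iff hσ hτ _).2 h, rfl⟩
  · rintro ⟨h, hh, rfl⟩
    exact ((mem_fixT_iff hσ hτ _).1 hh).mem_solutionSet hM

/-! ### The block operator `P` and the step size condition -/

variable (M)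

theorem inner_P (σ τ : ℝ) (h h' : Prod4 X Z W) : inner ℝ h (M.P σ τ h') =
    σ * inner ℝ h.fst h'.fst - M.μ * inner ℝ (M.BB (M.L h.fst)) h'.snd.fst
      - M.μ * inner ℝ (M.L h.fst) h'.snd.snd.fst - M.μ * inner ℝ (M.K h.fst) h'.snd.snd.snd
      - M.μ * inner ℝ (M.BB (M.L h'.fst)) h.snd.fst + τ * inner ℝ h.snd.fst h'.snd.fst
      - M.μ * inner ℝ (M.L h'.fst) h.snd.snd.fst + M.μ * inner ℝ h.snd.snd.fst h'.snd.snd.fst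
      - M.μ * inner ℝ (M.K h'.fst) h.snd.snd.snd
      + M.μ * inner ℝ h.snd.snd.snd h'.snd.snd.snd := by
  rw [Prod4.inner_def]
  change inner ℝ h.fst (σ • h'.fst - M.μ • adjoint M.L (M.BB h'.snd.fst)
      - M.μ • adjoint M.L h'.snd.snd.fst - M.μ • adjoint M.K h'.snd.snd.snd)
    + (inner ℝ h.snd.fst (-(M.μ • M.BB (M.L h'.fst)) + τ • h'.snd.fst)
    + (inner ℝ h.snd.snd.fst (-(M.μ • M.L h'.fst) + M.μ • h'.snd.snd.fst)
    + inner ℝ h.snd.snd.snd (-(M.μ • M.K h'.fst) + M.μ • h'.snd.snd.snd))) = _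
  simp only [inner_sub_right, inner_add_right, inner_neg_right, inner_smul_right,
    ContinuousLinearMap.adjoint_inner_right]
  rw [inner_BB_comm M (M.L h.fst), real_inner_comm h.snd.fst (M.BB (M.L h'.fst)),
    real_inner_comm h.snd.snd.fst (M.L h'.fst), real_inner_comm h.snd.snd.snd (M.K h'.fst)]
  ring

theorem P_isSymmetric (σ τ : ℝ) : (M.P σ τ).IsSymmetric := by
  intro h h'
  rw [real_inner_comm, inner_P, inner_P, real_inner_comm h.fst,
    real_inner_comm h.snd.fst h'.snd.fst,
    real_inner_comm h.snd.snd.fst h'.snd.snd.fst, real_inner_comm h.snd.snd.snd h'.snd.snd.snd]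
  ring

/-- Completing the squares in `w` and `z` leaves a quadratic form in `x` and `v`, which is bounded
below by a form in the two numbers `‖x‖` and `‖v‖`. -/
theorem le_inner_P_self (σ τ : ℝ) (h : Prod4 X Z W) :
    (σ - M.μ * M.normLK) * ‖h.fst‖ ^ 2 + τ * ‖h.snd.fst‖ ^ 2
      - 2 * (M.μ * ‖M.BB ∘L M.L‖) * (‖h.fst‖ * ‖h.snd.fst‖)
      + M.μ * ‖h.snd.snd.fst - M.L h.fst‖ ^ 2 + M.μ * ‖h.snd.snd.snd - M.K h.fst‖ ^ 2
      ≤ inner ℝ h (M.P σ τ h) := by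
  have hμ := M.μ_pos
  rw [inner_P]
  simp only [real_inner_self_eq_norm_sq]
  have h1 : ‖M.L h.fst‖ ^ 2 + ‖M.K h.fst‖ ^ 2 ≤ M.normLK * ‖h.fst‖ ^ 2 := by
    have h2 : ‖M.L h.fst‖ ^ 2 + ‖M.K h.fst‖ ^ 2
        = inner ℝ ((adjoint M.L ∘L M.L + adjoint M.K ∘L M.K) h.fst) h.fst := by
      simp [inner_add_left, ContinuousLinearMap.adjoint_inner_left]
    rw [h2]
    refine (real_inner_le_norm _ _).trans ?_
    rw [sq, ← mul_assoc]
    gcongr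
    exact ContinuousLinearMap.le_opNorm _ _
  have h2 : inner ℝ (M.BB (M.L h.fst)) h.snd.fst
      ≤ ‖M.BB ∘L M.L‖ * (‖h.fst‖ * ‖h.snd.fst‖) := by
    refine (real_inner_le_norm _ _).trans ?_
    rw [← mul_assoc]
    gcongr
    exact (M.BB ∘L M.L).le_opNorm _
  rw [norm_sub_sq_real, norm_sub_sq_real, real_inner_comm (M.L h.fst), real_inner_comm (M.K h.fst)]
  nlinarith [mul_le_mul_of_nonneg_left h1 hμ.le, mul_le_mul_of_nonneg_left h2 hμ.le]

theorem rho_pos {β : ℝ} (hβ : 0 < β) : 0 < M.rho β :=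
  one_div_pos.2 (lt_max_of_lt_left hβ)

section StepCondition

variable {M} {β σ τ : ℝ} (hs : M.StepCondition β σ τ) (hβ : 0 < β)
include hs hβ

/-- The step size condition cleared of denominators: the last inequality is `θ < 2`. -/
theorem StepCondition.bounds : 0 < τ ∧ 0 < σ - M.μ * M.normLK ∧
    (σ - M.μ * M.normLK + τ) < 2 * M.rho β *
      ((σ - M.μ * M.normLK) * τ - (M.μ * ‖M.BB ∘L M.L‖) ^ 2) := by
  obtain ⟨-, hτ, h⟩ := hs
  have hρ := M.rho_pos hβ
  have hτ0 : 0 < τ := lt_trans (by positivity) hτ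
  rw [div_lt_iff₀ (by positivity)] at hτ
  have h2 : 0 < 2 * M.rho β * τ - 1 := by linarith
  rw [← lt_sub_iff_add_lt', div_lt_iff₀ h2] at h
  have h3 : 0 ≤ 2 * M.rho β * M.μ ^ 2 * ‖M.BB ∘L M.L‖ ^ 2 := by positivity
  refine ⟨hτ0, ?_, by nlinarith⟩
  by_contra hn
  nlinarith [mul_nonneg (sub_nonneg.2 (not_lt.1 hn)) h2.le]

theorem StepCondition.det_pos :
    0 < (σ - M.μ * M.normLK) * τ - (M.μ * ‖M.BB ∘L M.L‖) ^ 2 := by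
  obtain ⟨h1, h2, h3⟩ := hs.bounds hβ
  exact pos_of_mul_pos_right (lt_trans (add_pos h2 h1) h3) (mul_pos two_pos (M.rho_pos hβ)).le

theorem StepCondition.theta_eq : M.theta β σ τ = (σ - M.μ * M.normLK + τ) / (M.rho β *
    ((σ - M.μ * M.normLK) * τ - (M.μ * ‖M.BB ∘L M.L‖) ^ 2)) := by
  unfold theta
  congr 1 <;> ring

theorem StepCondition.theta_mem : M.theta β σ τ ∈ Set.Ioo (0 : ℝ) 2 := by
  obtain ⟨h1, h2, h3⟩ := hs.bounds hβ
  have h4 := mul_pos (M.rho_pos hβ) (hs.det_pos hβ)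
  rw [hs.theta_eq hβ]
  refine ⟨div_pos (add_pos h2 h1) h4, ?_⟩
  rw [div_lt_iff₀ h4]
  linarith

/-- The smallest eigenvalue of a positive definite `2 × 2` matrix is at least the quotient of the
determinant and the trace; for the form of `le_inner_P_self` this quotient is `1 / (ρ θ)`. -/
theorem StepCondition.norm_sq_le_inner_P (h : Prod4 X Z W) :
    ‖h.fst‖ ^ 2 + ‖h.snd.fst‖ ^ 2 + M.rho β * M.theta β σ τ * (M.μ *
      (‖h.snd.snd.fst - M.L h.fst‖ ^ 2 + ‖h.snd.snd.snd - M.K h.fst‖ ^ 2))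
      ≤ M.rho β * M.theta β σ τ * inner ℝ h (M.P σ τ h) := by
  obtain ⟨h1, h2, h3⟩ := hs.bounds hβ
  have hdet := hs.det_pos hβ
  have hρ := M.rho_pos hβ
  have hθ : 0 ≤ M.rho β * M.theta β σ τ := mul_nonneg hρ.le (hs.theta_mem hβ).1.le
  have key := mul_le_mul_of_nonneg_left (M.le_inner_P_self σ τ h) hθ
  have e : M.rho β * M.theta β σ τ = (σ - M.μ * M.normLK + τ) /
      ((σ - M.μ * M.normLK) * τ - (M.μ * ‖M.BB ∘L M.L‖) ^ 2) := by
    rw [hs.theta_eq hβ]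
    field_simp
  set s := σ - M.μ * M.normLK
  set b := M.μ * ‖M.BB ∘L M.L‖
  set p := ‖h.fst‖
  set q := ‖h.snd.fst‖
  have h5 : p ^ 2 + q ^ 2 ≤
      M.rho β * M.theta β σ τ * (s * p ^ 2 + τ * q ^ 2 - 2 * b * (p * q)) := by
    rw [e, div_mul_eq_mul_div, le_div_iff₀ hdet]
    -- The difference of the two sides is `(s p - b q)² + (b p - τ q)²`.
    nlinarith [sq_nonneg (s * p - b * q), sq_nonneg (b * p - τ * q)]
  linarith

theorem StepCondition.posDef : PosDef (M.P σ τ) := by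
  refine ⟨M.P_isSymmetric σ τ, fun h hh => ?_⟩
  have h1 := hs.norm_sq_le_inner_P hβ h
  have hθ : 0 < M.rho β * M.theta β σ τ := mul_pos (M.rho_pos hβ) (hs.theta_mem hβ).1
  have hμ := M.μ_pos
  by_contra hn
  have h2 : M.rho β * M.theta β σ τ * inner ℝ h (M.P σ τ h) ≤ 0 :=
    mul_nonpos_of_nonneg_of_nonpos hθ.le (not_lt.1 hn)
  have h3 : 0 ≤ M.rho β * M.theta β σ τ * (M.μ *
      (‖h.snd.snd.fst - M.L h.fst‖ ^ 2 + ‖h.snd.snd.snd - M.K h.fst‖ ^ 2)) := by positivity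
  have hx : h.fst = 0 := by
    rw [← norm_eq_zero]
    nlinarith [sq_nonneg ‖h.snd.fst‖, sq_nonneg ‖h.fst‖]
  have hv : h.snd.fst = 0 := by
    rw [← norm_eq_zero]
    nlinarith [sq_nonneg ‖h.snd.fst‖, sq_nonneg ‖h.fst‖]
  have h4 : M.rho β * M.theta β σ τ * (M.μ *
      (‖h.snd.snd.fst - M.L h.fst‖ ^ 2 + ‖h.snd.snd.snd - M.K h.fst‖ ^ 2)) ≤ 0 := by
    nlinarith [sq_nonneg ‖h.snd.fst‖, sq_nonneg ‖h.fst‖]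
  rw [hx, map_zero, map_zero, sub_zero, sub_zero, ← mul_assoc] at h4
  have h5 := nonpos_of_mul_nonpos_right h4 (mul_pos hθ hμ)
  have hw : h.snd.snd.fst = 0 := by
    rw [← norm_eq_zero]
    nlinarith [sq_nonneg ‖h.snd.snd.fst‖, sq_nonneg ‖h.snd.snd.snd‖]
  have hz : h.snd.snd.snd = 0 := by
    rw [← norm_eq_zero]
    nlinarith [sq_nonneg ‖h.snd.snd.fst‖, sq_nonneg ‖h.snd.snd.snd‖]
  exact hh (Prod4.ext hx hv hw hz)

end StepCondition

/-! ### Averagedness of `T` -/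

/-- The inclusion `P (h - T h) ∈ F h + G (T h)` behind the definition of `T`, componentwise: `F` is
the map `(x, v, w, z) ↦ (∇𝔡 x, μ B*B v, 0, 0)` and `G` is the sum of a skew linear map and of the
subdifferentials of `μ Ψ`, `μ Ψ^*` and `μ ι_C^*`. -/
theorem exists_P_sub_T [FiniteDimensional ℝ Z] {σ τ : ℝ} (hσ : 0 < σ) (hτ : 0 < τ)
    (h : Prod4 X Z W) : ∃ p q r, p ∈ subdiff M.Ψ (M.T σ τ h).snd.fst ∧
      (M.T σ τ h).snd.snd.fst ∈ subdiff M.Ψ q ∧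
      (M.T σ τ h).snd.snd.snd ∈ subdiff (indicatorFn M.C) r ∧
      M.P σ τ (h - M.T σ τ h) = mk4
        (gradient M.d h.fst + M.μ • adjoint M.L (M.BB (M.T σ τ h).snd.fst)
          + M.μ • adjoint M.L (M.T σ τ h).snd.snd.fst + M.μ • adjoint M.K (M.T σ τ h).snd.snd.snd)
        (M.μ • p - M.μ • M.BB (M.L (M.T σ τ h).fst) + M.μ • M.BB h.snd.fst)
        (M.μ • q - M.μ • M.L (M.T σ τ h).fst) (M.μ • r - M.μ • M.K (M.T σ τ h).fst) := by
  have hμ := M.μ_pos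
  have h2 := prox_mem_subdiff M.Ψ_gamma0 M.Ψ_coercive (div_pos hμ hτ)
    ((2 * M.μ / τ) • M.BB (M.L (M.xi σ h)) - (M.μ / τ) • M.BB (M.L h.fst)
      + (h.snd.fst - (M.μ / τ) • M.BB h.snd.fst))
  have h3 := prox_mem_subdiff M.Ψ_gamma0 M.Ψ_coercive one_pos
    ((2 : ℝ) • M.L (M.xi σ h) - M.L h.fst + h.snd.snd.fst)
  have h4 := metricProj_mem_subdiff M.C_nonempty M.C_closed M.C_convex
    ((2 : ℝ) • M.K (M.xi σ h) - M.K h.fst + h.snd.snd.snd)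
  rw [one_div_one, one_smul] at h3
  refine ⟨_, _, _, h2, h3, h4, Prod4.ext ?_ ?_ ?_ ?_⟩
  · change σ • (h.fst - (M.T σ τ h).fst)
      - M.μ • adjoint M.L (M.BB (h.snd.fst - (M.T σ τ h).snd.fst))
      - M.μ • adjoint M.L (h.snd.snd.fst - (M.T σ τ h).snd.snd.fst)
      - M.μ • adjoint M.K (h.snd.snd.snd - (M.T σ τ h).snd.snd.snd) = gradient M.d h.fst
        + M.μ • adjoint M.L (M.BB (M.T σ τ h).snd.fst)
        + M.μ • adjoint M.L (M.T σ τ h).snd.snd.fst + M.μ • adjoint M.K (M.T σ τ h).snd.snd.snd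
    have e : σ • (h.fst - (M.T σ τ h).fst) = gradient M.d h.fst
        + M.μ • adjoint M.L (M.BB h.snd.fst) + M.μ • adjoint M.L h.snd.snd.fst
        + M.μ • adjoint M.K h.snd.snd.snd := by
      rw [T_fst]
      simp only [xi]
      match_scalars <;> field_simp <;> ring
    rw [e]
    simp only [map_sub]
    module
  · change -(M.μ • M.BB (M.L (h.fst - (M.T σ τ h).fst)))
      + τ • (h.snd.fst - (M.T σ τ h).snd.fst) = M.μ • _ - M.μ • M.BB (M.L (M.T σ τ h).fst)
        + M.μ • M.BB h.snd.fst
    rw [← T_snd_fst, ← T_fst σ τ]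
    simp only [map_sub]
    match_scalars <;> field_simp <;> ring
  · change -(M.μ • M.L (h.fst - (M.T σ τ h).fst))
      + M.μ • (h.snd.snd.fst - (M.T σ τ h).snd.snd.fst) = M.μ • _ - M.μ • M.L (M.T σ τ h).fst
    rw [T_snd_snd_fst, ← T_fst σ τ]
    simp only [map_sub]
    module
  · change -(M.μ • M.K (h.fst - (M.T σ τ h).fst))
      + M.μ • (h.snd.snd.snd - (M.T σ τ h).snd.snd.snd) = M.μ • _ - M.μ • M.K (M.T σ τ h).fst
    rw [T_snd_snd_snd, ← T_fst σ τ]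
    simp only [map_sub]
    module

/-- Monotonicity of `G` in the inclusion `P (h - T h) ∈ F h + G (T h)`. -/
theorem inner_F_le_inner_P [FiniteDimensional ℝ Z] {σ τ : ℝ} (hσ : 0 < σ) (hτ : 0 < τ)
    (h h' : Prod4 X Z W) :
    inner ℝ (M.T σ τ h - M.T σ τ h').fst (gradient M.d h.fst - gradient M.d h'.fst)
      + inner ℝ (M.T σ τ h - M.T σ τ h').snd.fst (M.μ • M.BB (h - h').snd.fst)
      ≤ inner ℝ (M.T σ τ h - M.T σ τ h') (M.P σ τ (h - h' - (M.T σ τ h - M.T σ τ h'))) := by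
  have hμ := M.μ_pos
  obtain ⟨p, q, r, hp, hq, hr, e⟩ := M.exists_P_sub_T hσ hτ h
  obtain ⟨p', q', r', hp', hq', hr', e'⟩ := M.exists_P_sub_T hσ hτ h'
  have hp := subdiff_monotone M.Ψ_gamma0.ne_bot M.Ψ_gamma0.proper hp hp'
  have hq := subdiff_monotone M.Ψ_gamma0.ne_bot M.Ψ_gamma0.proper hq hq'
  have hr := subdiff_monotone (indicatorFn_ne_bot M.C) (indicatorFn_proper M.C_nonempty) hr hr'
  rw [show h - h' - (M.T σ τ h - M.T σ τ h') = h - M.T σ τ h - (h' - M.T σ τ h') by abel,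
    map_sub, e, e', Prod4.inner_def]
  set t := M.T σ τ h
  set t' := M.T σ τ h'
  change inner ℝ (t.fst - t'.fst) _
      + inner ℝ (t.snd.fst - t'.snd.fst) (M.μ • M.BB (h.snd.fst - h'.snd.fst)) ≤
    inner ℝ (t.fst - t'.fst) (gradient M.d h.fst + M.μ • adjoint M.L (M.BB t.snd.fst)
        + M.μ • adjoint M.L t.snd.snd.fst + M.μ • adjoint M.K t.snd.snd.snd
        - (gradient M.d h'.fst + M.μ • adjoint M.L (M.BB t'.snd.fst)
        + M.μ • adjoint M.L t'.snd.snd.fst + M.μ • adjoint M.K t'.snd.snd.snd))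
    + (inner ℝ (t.snd.fst - t'.snd.fst) (M.μ • p - M.μ • M.BB (M.L t.fst) + M.μ • M.BB h.snd.fst
        - (M.μ • p' - M.μ • M.BB (M.L t'.fst) + M.μ • M.BB h'.snd.fst))
    + (inner ℝ (t.snd.snd.fst - t'.snd.snd.fst) (M.μ • q - M.μ • M.L t.fst
        - (M.μ • q' - M.μ • M.L t'.fst))
    + inner ℝ (t.snd.snd.snd - t'.snd.snd.snd) (M.μ • r - M.μ • M.K t.fst
        - (M.μ • r' - M.μ • M.K t'.fst))))
  have e1 : gradient M.d h.fst + M.μ • adjoint M.L (M.BB t.snd.fst)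
        + M.μ • adjoint M.L t.snd.snd.fst + M.μ • adjoint M.K t.snd.snd.snd
        - (gradient M.d h'.fst + M.μ • adjoint M.L (M.BB t'.snd.fst)
        + M.μ • adjoint M.L t'.snd.snd.fst + M.μ • adjoint M.K t'.snd.snd.snd)
      = (gradient M.d h.fst - gradient M.d h'.fst)
        + M.μ • adjoint M.L (M.BB (t.snd.fst - t'.snd.fst))
        + M.μ • adjoint M.L (t.snd.snd.fst - t'.snd.snd.fst)
        + M.μ • adjoint M.K (t.snd.snd.snd - t'.snd.snd.snd) := by
    simp only [map_sub]
    module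
  have e2 : M.μ • p - M.μ • M.BB (M.L t.fst) + M.μ • M.BB h.snd.fst
        - (M.μ • p' - M.μ • M.BB (M.L t'.fst) + M.μ • M.BB h'.snd.fst)
      = M.μ • (p - p') - M.μ • M.BB (M.L (t.fst - t'.fst))
        + M.μ • M.BB (h.snd.fst - h'.snd.fst) := by
    simp only [map_sub]
    module
  have e3 : M.μ • q - M.μ • M.L t.fst - (M.μ • q' - M.μ • M.L t'.fst)
      = M.μ • (q - q') - M.μ • M.L (t.fst - t'.fst) := by
    simp only [map_sub]
    module
  have e4 : M.μ • r - M.μ • M.K t.fst - (M.μ • r' - M.μ • M.K t'.fst)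
      = M.μ • (r - r') - M.μ • M.K (t.fst - t'.fst) := by
    simp only [map_sub]
    module
  rw [e1, e2, e3, e4]
  generalize t.fst - t'.fst = a at *
  generalize t.snd.fst - t'.snd.fst = b at *
  generalize t.snd.snd.fst - t'.snd.snd.fst = c at *
  generalize t.snd.snd.snd - t'.snd.snd.snd = d at *
  simp only [inner_add_right, inner_sub_right, inner_smul_right,
    ContinuousLinearMap.adjoint_inner_right]
  simp only [← inner_sub_right]
  rw [← inner_BB_comm M (M.L a) b, real_inner_comm b (M.BB (M.L a)), real_inner_comm c (M.L a),
    real_inner_comm d (M.K a)]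
  rw [real_inner_comm] at hq hr
  have := mul_nonneg hμ.le hp
  have := mul_nonneg hμ.le hq
  have := mul_nonneg hμ.le hr
  linarith

/-- The map `(x, v) ↦ (∇𝔡 x, μ B*B v)` is `ρ`-cocoercive. -/
theorem cocoercive {β : ℝ} (hM : M.Assumptions β) (x x' : X) (v : Z) :
    M.rho β * (‖gradient M.d x - gradient M.d x'‖ ^ 2 + ‖M.μ • M.BB v‖ ^ 2)
      ≤ inner ℝ (x - x') (gradient M.d x - gradient M.d x') + inner ℝ v (M.μ • M.BB v) := by
  have hβ := hM.β_pos
  have hμ := M.μ_pos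
  have hρ := M.rho_pos hβ
  have h1 := gradient_cocoercive hβ M.hasGradientAt_d
    (fun x y => hM.overall_convexity.gradient_le (M.hasGradientAt_d x) y) hM.lipschitz x x'
  have h2 : M.rho β ≤ 1 / β := one_div_le_one_div_of_le hβ (le_max_left _ _)
  have h3 : M.rho β * (M.μ * ‖M.B‖ ^ 2) ≤ 1 := by
    calc M.rho β * (M.μ * ‖M.B‖ ^ 2) ≤ M.rho β * max β (M.μ * ‖M.B‖ ^ 2) := by
          gcongr; exact le_max_right _ _
      _ = 1 := one_div_mul_cancel (lt_max_of_lt_left hβ).ne'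
  have h4 : ‖M.BB v‖ ≤ ‖M.B‖ * ‖M.B v‖ := by
    have := (adjoint M.B).le_opNorm (M.B v)
    rwa [LinearIsometryEquiv.norm_map] at this
  rw [real_inner_comm, norm_smul, Real.norm_of_nonneg hμ.le, inner_smul_right, ← inner_BB_comm,
    inner_BB, real_inner_self_eq_norm_sq, mul_add]
  have h5 : M.rho β * (M.μ * ‖M.BB v‖) ^ 2 ≤ M.μ * ‖M.B v‖ ^ 2 := by
    calc M.rho β * (M.μ * ‖M.BB v‖) ^ 2 ≤ M.rho β * (M.μ * (‖M.B‖ * ‖M.B v‖)) ^ 2 := by gcongr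
      _ = (M.rho β * (M.μ * ‖M.B‖ ^ 2)) * (M.μ * ‖M.B v‖ ^ 2) := by ring
      _ ≤ 1 * (M.μ * ‖M.B v‖ ^ 2) := by gcongr
      _ = _ := one_mul _
  have h6 := mul_le_mul_of_nonneg_right h2 (sq_nonneg ‖gradient M.d x - gradient M.d x'‖)
  linarith

/-- Young's inequality. -/
theorem neg_norm_sq_le {V : Type*} [NormedAddCommGroup V] [InnerProductSpace ℝ V] {ρ : ℝ}
    (hρ : 0 < ρ) (e g : V) : -(1 / (4 * ρ)) * ‖e‖ ^ 2 ≤ ρ * ‖g‖ ^ 2 - inner ℝ e g := by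
  have h1 := real_inner_le_norm e g
  have h2 : ρ * ‖g‖ ^ 2 - ‖e‖ * ‖g‖ + 1 / (4 * ρ) * ‖e‖ ^ 2
      = ρ * (‖g‖ - 1 / (2 * ρ) * ‖e‖) ^ 2 := by
    field_simp
    ring
  have h3 : 0 ≤ ρ * (‖g‖ - 1 / (2 * ρ) * ‖e‖) ^ 2 := by positivity
  linarith

theorem averaged_T [FiniteDimensional ℝ Z] {β σ τ : ℝ} (hM : M.Assumptions β)
    (hs : M.StepCondition β σ τ) :
    AveragedWrt (M.P σ τ) (2 / (4 - M.theta β σ τ)) (M.T σ τ) := by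
  have hβ := hM.β_pos
  have hρ := M.rho_pos hβ
  obtain ⟨hθ0, hθ2⟩ := hs.theta_mem hβ
  have h4 : 0 < 4 - M.theta β σ τ := by linarith
  refine averagedWrt_of_inner_ge (hs.posDef hβ) (by positivity)
    ((div_lt_one h4).2 (by linarith)) fun h h' => ?_
  have h1 := M.inner_F_le_inner_P hs.1 (hs.bounds hβ).1 h h'
  have h2 := M.cocoercive hM h.fst h'.fst (h - h').snd.fst
  set t := M.T σ τ h - M.T σ τ h'
  set e := h - h' - t with he
  have h3 := hs.norm_sq_le_inner_P hβ e
  have hμ := M.μ_pos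
  have h3' : 0 ≤ M.rho β * M.theta β σ τ * (M.μ *
      (‖e.snd.snd.fst - M.L e.fst‖ ^ 2 + ‖e.snd.snd.snd - M.K e.fst‖ ^ 2)) := by positivity
  have e1 : t.fst = (h.fst - h'.fst) - e.fst := by
    change t.fst = (h.fst - h'.fst) - (h.fst - h'.fst - t.fst)
    abel
  have e2 : t.snd.fst = (h - h').snd.fst - e.snd.fst := by
    change t.snd.fst = (h.snd.fst - h'.snd.fst) - (h.snd.fst - h'.snd.fst - t.snd.fst)
    abel
  rw [e1, e2, inner_sub_left, inner_sub_left _ e.snd.fst] at h1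
  have h5 := neg_norm_sq_le hρ e.fst (gradient M.d h.fst - gradient M.d h'.fst)
  have h6 := neg_norm_sq_le hρ e.snd.fst (M.μ • M.BB (h - h').snd.fst)
  have h7 : -(M.theta β σ τ / 4) * inner ℝ e (M.P σ τ e) ≤ inner ℝ t (M.P σ τ e) := by
    have h8 : 1 / (4 * M.rho β) * (‖e.fst‖ ^ 2 + ‖e.snd.fst‖ ^ 2) ≤
        1 / (4 * M.rho β) * (M.rho β * M.theta β σ τ * inner ℝ e (M.P σ τ e)) := by
      gcongr
      linarith
    have h9 : 1 / (4 * M.rho β) * (M.rho β * M.theta β σ τ * inner ℝ e (M.P σ τ e))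
        = M.theta β σ τ / 4 * inner ℝ e (M.P σ τ e) := by
      field_simp
    linarith
  have e3 : h - h' = t + e := by rw [he]; abel
  rw [e3, inner_add_left, mul_comm 2, div_mul_eq_mul_div, div_mul_eq_mul_div, le_div_iff₀ h4]
  linarith

end Model

end NRC

end

theorem theorem2 {X Y Z Zt W : Type*}
    [NormedAddCommGroup X] [InnerProductSpace ℝ X] [FiniteDimensional ℝ X] [CompleteSpace X]
    [NormedAddCommGroup Y] [InnerProductSpace ℝ Y] [FiniteDimensional ℝ Y]
    [NormedAddCommGroup Z] [InnerProductSpace ℝ Z] [FiniteDimensional ℝ Z] [CompleteSpace Z]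
    [NormedAddCommGroup Zt] [InnerProductSpace ℝ Zt] [FiniteDimensional ℝ Zt] [CompleteSpace Zt]
    [NormedAddCommGroup W] [InnerProductSpace ℝ W] [FiniteDimensional ℝ W] [CompleteSpace W]
    (M : NRC.Model X Y Z Zt W) (β : ℝ) (hM : M.Assumptions β) :
    (∀ σ τ : ℝ, 0 < σ → 0 < τ → M.solutionSet = NRC.Xi '' M.fixT σ τ) ∧
    0 < M.rho β ∧
    (∀ σ τ : ℝ, M.StepCondition β σ τ →
      NRC.PosDef (M.P σ τ) ∧
      M.theta β σ τ ∈ Set.Ioo (0 : ℝ) 2 ∧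
      NRC.AveragedWrt (M.P σ τ) (2 / (4 - M.theta β σ τ)) (M.T σ τ) ∧
      ∀ h : ℕ → NRC.Prod4 X Z W, (∀ k, h (k + 1) = M.T σ τ (h k)) →
        ∃ h' ∈ M.fixT σ τ, Tendsto h atTop (𝓝 h') ∧
          Tendsto (fun k => NRC.Xi (h k)) atTop (𝓝 (NRC.Xi h')) ∧
          NRC.Xi h' ∈ M.solutionSet) := by
  have hfix : ∀ {σ τ : ℝ}, 0 < σ → 0 < τ → M.solutionSet = NRC.Xi '' M.fixT σ τ :=
    fun hσ hτ => NRC.Model.solutionSet_eq hM hσ hτ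
  refine ⟨fun _ _ => hfix, M.rho_pos hM.β_pos, fun σ τ hs => ?_⟩
  have hP := hs.posDef hM.β_pos
  have hT := M.averaged_T hM hs
  have hS := hfix hs.1 (hs.bounds hM.β_pos).1
  refine ⟨hP, hs.theta_mem hM.β_pos, hT, fun h hh => ?_⟩
  have hne : ∃ y, y = M.T σ τ y := by
    obtain ⟨x, hx⟩ := hM.exists_minimizer
    rw [hS] at hx
    obtain ⟨y, hy, -⟩ := hx
    exact ⟨y, hy⟩
  obtain ⟨y, hy, hlim⟩ := hT.exists_tendsto hP hne hh
  have hXi : Continuous (NRC.Xi : NRC.Prod4 X Z W → X) := WithLp.continuous_fst 2 _ _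
  exact ⟨y, hy, hlim, (hXi.tendsto y).comp hlim, hS ▸ ⟨y, hy, rfl⟩⟩
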